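/- **Notation.** Let $A=(a_{i,j})$ be an $N\times N$ matrix over a commutative ring with unity, with rows and columns indexed by $\{1,\dots,N\}$. Its rook polynomial is $R(x;A)=1+\sum_{d=1}^{N}x^d\sum_{S\subseteq\{1,\dots,N\},\,|S|=d}\ \sum_{\sigma}\prod_{i\in S}a_{i,\sigma(i)}$, where $\sigma$ runs over the injections $S\to\{1,\dots,N\}$; its permanent is $\operatorname{per}(A)=\sum_{\sigma\in \mathrm{Sym}(N)}\prod_{i}a_{i,\sigma(i)}$. For $n\ge1$ and $d\in\mathbb Z$ let $T_n^{(d)}$ be the $n\times n$ matrix with $(i,j)$ entry $1$ if $j-i=d$ and $0$ otherwise, and let $P_n$ be the $n\times n$ permutation matrix with $(i,j)$ entry $1$ if $j-i\equiv1\pmod n$ and $0$ otherwise. $J_k$ is the $k\times k$ all-ones matrix and $\otimes$ is the Kronecker product. For integers $k,t\ge0$ let $G_t^{[k]}$ be the set of vectors $(1^{\langle l_1\rangle},\dots,t^{\langle l_t\rangle})$ ($l_1$ ones, $l_2$ twos, and so on) with $0\le l_i\le k$, and let $G_{s,t}^{[k]}$ be its subset given by $l_1+\dots+l_t=s$. Write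 $u=(1^{\langle k\rangle},\dots,r^{\langle k\rangle})$ for a given $r\le t$, and $\{\gamma\}$ for the multiset of components of a vector $\gamma$. The square matrix $K_t^{[k]}(a_0,\dots,a_t)$, indexed by $G_t^{[k]}$, is defined as follows. $K_0^{[k]}(a_0)=\sum_{d=0}^k d!\binom kd^2a_0^d$. If $t\ge1$, $\alpha=(1^{\langle l_1\rangle},\dots,t^{\langle l_t\rangle})$ and $\beta=(1^{\langle k-v+\sum p_i\rangle},2^{\langle l_1-p_1\rangle},\dots,t^{\langle l_{t-1}-p_{t-1}\rangle})$ with integers $0\le p_i\le l_i$ ($1\le i\le t-1$) and $\sum p_i\le v\le k$, then the entry at $(\alpha,\beta)$ is $$\Bigl(\prod_{i=1}^{t-1}\binom{l_i}{p_i}a_i^{p_i}\Bigr)\binom{k}{v-\sum p_i}a_0^{\,v-\sum p_i}\sum_{d=0}^{\min(l_t,k-v)}(d+v)!\binom{k}{d+v}\binom{l_t}{d}a_t^d ;$$ all other entries are $0$. The square matrix $\Pi_{s,t}^{[k]}(a_0,\dots,a_t)$, indexed by $G_{s,t}^{[k]}$ ($0\le s\le kt$), is defined as follows. $\Pi_{0,0}^{[k]}(a_0)=k!\,a_0^k$.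 If $t\ge1$, $\alpha=(1^{\langle l_1\rangle},\dots,t^{\langle l_t\rangle})$ and $\beta=(1^{\langle l_t+\sum p_i\rangle},2^{\langle l_1-p_1\rangle},\dots,t^{\langle l_{t-1}-p_{t-1}\rangle})$ with integers $0\le p_i\le l_i$ ($1\le i\le t-1$) and $\sum p_i\le k-l_t$, then the entry at $(\alpha,\beta)$ is $$k!\binom{k}{l_t+\sum p_i}\Bigl(\prod_{i=1}^{t-1}\binom{l_i}{p_i}a_i^{p_i}\Bigr)a_0^{\,k-l_t-\sum p_i}\,a_t^{\,l_t};$$ all other entries are $0$. For a finite index set $X$ of a matrix $M$ fix any bijection $\mathbf L:X\to\{1,\dots,|X|\}$, by which the rows and columns are numbered; $M(\mathbf L(\alpha)\mid\mathbf L(\beta))$ denotes $M$ with row number $\mathbf L(\alpha)$ and column number $\mathbf L(\beta)$ deleted. $I$ is the identity matrix of the appropriate size, and the determinant of the empty matrix is $1$. **Theorem.** Let $k\ge0$ and $0\le r\le t$ be integers and let $a_{-r},a_{-r+1},\dots,a_{-r+t}$ be elements of a commutative ring $\mathcal R$ with unity. Put $K=K_t^{[k]}(a_{-r}x,a_{-r+1}x,\dots,a_{-r+t}x)$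 (over $\mathcal R[x]$) and $\Pi_l=\Pi_{l,t}^{[k]}(a_{-r},a_{-r+1},\dots,a_{-r+t})$ (over $\mathcal R$). Then $\det(I-yK)$ is invertible in $\mathcal R[x][[y]]$, each $\det(I-x\Pi_l)$ is invertible in $\mathcal R[[x]]$, and the following hold in $\mathcal R[x][[y]]$ (the first two) and in $\mathcal R[[x]]$ (the last two), for every choice of the bijections $\mathbf L$: $$1+\sum_{n=1}^\infty R\Bigl(x;\Bigl(\sum_{i=0}^ta_{-r+i}T_n^{(-r+i)}\Bigr)\otimes J_k\Bigr)y^n=\frac{(-1)^{\mathbf L(u)}\displaystyle\sum_{\gamma\in G_t^{[k]},\ \{\gamma\}\supseteq\{u\}}(-1)^{\mathbf L(\gamma)}\det\bigl((I-yK)(\mathbf L(\gamma)\mid\mathbf L(u))\bigr)}{\det(I-yK)},$$ $$\sum_{n=1}^\infty R\Bigl(x;\Bigl(\sum_{i=0}^ta_{-r+i}P_n^{-r+i}\Bigr)\otimes J_k\Bigr)y^n=\frac{-y\,\frac{d}{dy}\det(I-yK)}{\det(I-yK)},$$ $$1+\sum_{n=1}^\infty \operatorname{per}\Bigl(\Bigl(\sum_{i=0}^ta_{-r+i}T_n^{(-r+i)}\Bigr)\otimes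 J_k\Bigr)x^n=\frac{\det\bigl((I-x\Pi_{rk})(\mathbf L(u)\mid\mathbf L(u))\bigr)}{\det(I-x\Pi_{rk})},$$ $$\sum_{n=1}^\infty \operatorname{per}\Bigl(\Bigl(\sum_{i=0}^ta_{-r+i}P_n^{-r+i}\Bigr)\otimes J_k\Bigr)x^n=\sum_{l=0}^{kt}\frac{-x\,\frac{d}{dx}\det(I-x\Pi_l)}{\det(I-x\Pi_l)}.$$ -/

import Mathlib

open scoped Kronecker Polynomial BigOperators

namespace RookToeplitz

/-! ### Permanents, rook polynomials, Toeplitz matrices and circulants -/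

/-- The rook polynomial `R(x; A) = ∑_S x^|S| ∑_σ ∏_{i ∈ S} a_{i, σ(i)}`, where `S` runs over the
sets of rows and `σ` over the injections of `S` into the set of columns (`S = ∅` gives the
constant term `1`). -/
noncomputable def rookPoly {R m n : Type*} [CommRing R] [Fintype m] [DecidableEq m]
    [Fintype n] [DecidableEq n] (A : Matrix m n R) : R[X] :=
  ∑ S : Finset m, Polynomial.C (∑ σ : (S ↪ n), ∏ i : S, A i (σ i)) * Polynomial.X ^ S.card

/-- The `n × n` matrix `T_n^{(d)}`: entry `1` where `j - i = d`, and `0` elsewhere. -/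
def TMat (R : Type*) [CommRing R] (n : ℕ) (d : ℤ) : Matrix (Fin n) (Fin n) R :=
  Matrix.of fun i j => if (j : ℤ) - (i : ℤ) = d then 1 else 0

/-- The `n × n` matrix `P_n`: entry `1` where `j - i ≡ 1 (mod n)`, and `0` elsewhere. -/
def PMat (R : Type*) [CommRing R] (n : ℕ) : Matrix (Fin n) (Fin n) R :=
  Matrix.of fun i j => if (j : ℤ) - (i : ℤ) ≡ 1 [ZMOD (n : ℤ)] then 1 else 0

/-- The `k × k` all-ones matrix `J_k`. -/
def JMat (R : Type*) [CommRing R] (k : ℕ) : Matrix (Fin k) (Fin k) R :=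
  Matrix.of fun _ _ => 1

/-- The Toeplitz matrix `∑_{i=0}^t a_{-r+i} T_n^{(-r+i)}`; here `a i` stands for `a_{-r+i}`. -/
def toeplitz {R : Type*} [CommRing R] {t : ℕ} (r : ℕ) (a : Fin (t + 1) → R) (n : ℕ) :
    Matrix (Fin n) (Fin n) R :=
  ∑ i : Fin (t + 1), a i • TMat R n (-(r : ℤ) + ((i : ℕ) : ℤ))

/-- The circulant `∑_{i=0}^t a_{-r+i} P_n^{-r+i}`, with integer powers of the permutation matrix
`P_n`; here `a i` stands for `a_{-r+i}`. -/
noncomputable def circulant {R : Type*} [CommRing R] {t : ℕ} (r : ℕ) (a : Fin (t + 1) → R)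
    (n : ℕ) : Matrix (Fin n) (Fin n) R :=
  ∑ i : Fin (t + 1), a i • PMat R n ^ (-(r : ℤ) + ((i : ℕ) : ℤ))

/-! ### The index sets -/

/-- `G_t^{[k]}`: the vector `(1^{⟨l_1⟩}, …, t^{⟨l_t⟩})` with `0 ≤ l_i ≤ k` is recorded by its
multiplicities `l_1, …, l_t`. -/
abbrev G (k t : ℕ) : Type := Fin t → Fin (k + 1)

/-- `G_{r,t}^{[k]}`: the elements of `G_t^{[k]}` with `l_1 + ⋯ + l_t = r`. -/
abbrev GSum (k r t : ℕ) : Type := {l : G k t // ∑ i, (l i : ℕ) = r}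

/-- The element `(1^{⟨k⟩}, …, r^{⟨k⟩})` of `G_t^{[k]}`. -/
def full (k r t : ℕ) : G k t := fun i => if (i : ℕ) < r then Fin.last k else 0

theorem sum_full (k : ℕ) {r t : ℕ} (h : r ≤ t) : ∑ i, (full k r t i : ℕ) = r * k := by
  have h1 : ∀ i : Fin t, (full k r t i : ℕ) = (fun j : ℕ => if j < r then k else 0) i := by
    intro i
    by_cases hi : (i : ℕ) < r <;> simp [full, hi]
  rw [Finset.sum_congr rfl fun i _ => h1 i,
    Fin.sum_univ_eq_sum_range (fun j : ℕ => if j < r then k else 0) t, ← Finset.sum_filter]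
  have h2 : (Finset.range t).filter (fun j => j < r) = Finset.range r := by
    ext j
    simp only [Finset.mem_filter, Finset.mem_range]
    omega
  rw [h2]
  simp

/-- The same vector `(1^{⟨k⟩}, …, r^{⟨k⟩})` as an element of `G_{rk,t}^{[k]}`, for `r ≤ t`. -/
def fullSum (k : ℕ) {r t : ℕ} (h : r ≤ t) : GSum k (r * k) t := ⟨full k r t, sum_full k h⟩

/-! ### The matrices `K_t^{[k]}` and `Π_{r,t}^{[k]}` -/

/-- For `α = (1^{⟨l_1⟩}, …)` and `β = (1^{⟨m_1⟩}, …)` in `G_{t+1}^{[k]}`, the numbers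
`p_i = l_i - m_{i+1}`, `1 ≤ i ≤ t` (the index `i : Fin t` counts from `0`). They are the only
possible solution of `m_{i+1} = l_i - p_i`, and satisfy it with `0 ≤ p_i ≤ l_i` if and only if
`m_{i+1} ≤ l_i`; all uses below are guarded by this condition. -/
def usedOld {k t : ℕ} (α β : G k (t + 1)) (i : Fin t) : ℕ := (α i.castSucc : ℕ) - (β i.succ : ℕ)

/-- The number `v` with `m_1 = k - v + ∑ p_i`; as `m_1 ≤ k`, one has `∑ p_i ≤ v`, and `v ≤ k`
if and only if `∑ p_i ≤ m_1`. -/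
def usedAll {k t : ℕ} (α β : G k (t + 1)) : ℕ := k + (∑ i, usedOld α β i) - (β 0 : ℕ)

/-- The matrix `K_t^{[k]}(a_0, …, a_t)` on `G_t^{[k]}`. -/
def KMat {S : Type*} [CommRing S] (k : ℕ) :
    (t : ℕ) → (Fin (t + 1) → S) → Matrix (G k t) (G k t) S
  | 0, a => Matrix.of fun _ _ =>
      ∑ d ∈ Finset.range (k + 1), ((d.factorial * k.choose d ^ 2 : ℕ) : S) * a 0 ^ d
  | t + 1, a => Matrix.of fun α β =>
      if (∀ i : Fin t, β i.succ ≤ α i.castSucc) ∧ ∑ i, usedOld α β i ≤ (β 0 : ℕ) then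
        ((∏ i : Fin t, (α i.castSucc : ℕ).choose (usedOld α β i) : ℕ) : S)
          * ((k.choose (usedAll α β - ∑ i, usedOld α β i) : ℕ) : S)
          * a 0 ^ (usedAll α β - ∑ i, usedOld α β i)
          * (∏ i : Fin t, a i.succ.castSucc ^ usedOld α β i)
          * ∑ d ∈ Finset.range (min (α (Fin.last t) : ℕ) (k - usedAll α β) + 1),
              (((d + usedAll α β).factorial * k.choose (d + usedAll α β)
                * (α (Fin.last t) : ℕ).choose d : ℕ) : S) * a (Fin.last (t + 1)) ^ d
      else 0

/-- The matrix `Π_{r,t}^{[k]}(a_0, …, a_t)` on `G_{r,t}^{[k]}`; since `m_1 ≤ k`, the requirement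
`∑ p_i ≤ k - l_t` is part of `m_1 = l_t + ∑ p_i`. -/
def PiMat {S : Type*} [CommRing S] (k r : ℕ) :
    (t : ℕ) → (Fin (t + 1) → S) → Matrix (GSum k r t) (GSum k r t) S
  | 0, a => Matrix.of fun _ _ => (k.factorial : S) * a 0 ^ k
  | t + 1, a => Matrix.of fun α β =>
      if (∀ i : Fin t, β.1 i.succ ≤ α.1 i.castSucc) ∧
          (β.1 0 : ℕ) = (α.1 (Fin.last t) : ℕ) + ∑ i, usedOld α.1 β.1 i then
        ((k.factorial * k.choose ((α.1 (Fin.last t) : ℕ) + ∑ i, usedOld α.1 β.1 i)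
            * ∏ i : Fin t, (α.1 i.castSucc : ℕ).choose (usedOld α.1 β.1 i) : ℕ) : S)
          * a 0 ^ (k - (α.1 (Fin.last t) : ℕ) - ∑ i, usedOld α.1 β.1 i)
          * (∏ i : Fin t, a i.succ.castSucc ^ usedOld α.1 β.1 i)
          * a (Fin.last (t + 1)) ^ (α.1 (Fin.last t) : ℕ)
      else 0

/-! ### Determinants, minors and generating functions -/

/-- The matrix `I - y M` with entries in `S[y]`. -/
noncomputable def oneSub {S ι : Type*} [CommRing S] [DecidableEq ι] (M : Matrix ι ι S) :
    Matrix ι ι S[X] :=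
  1 - (Polynomial.X : S[X]) • M.map Polynomial.C

/-- The minor `det M(L(α) | L(β))`: the rows and columns of `M` are numbered by the bijection `L`,
and the row with number `L(α)` and the column with number `L(β)` are deleted. -/
def minor {S ι : Type*} [CommRing S] {N : ℕ} (L : ι ≃ Fin (N + 1)) (M : Matrix ι ι S)
    (α β : ι) : S :=
  ((M.submatrix L.symm L.symm).submatrix (L α).succAbove (L β).succAbove).det

/-- The power series `∑_{n ≥ 1} f(n) y^n`. -/
def gen {S : Type*} [CommRing S] (f : ℕ → S) : PowerSeries S :=
  PowerSeries.mk fun n => if n = 0 then 0 else f n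

/-- The quotient of two polynomials as a power series; it is the genuine quotient when the
denominator is a unit of the ring of power series. -/
noncomputable def quot {S : Type*} [CommRing S] (f g : S[X]) : PowerSeries S :=
  (f : PowerSeries S) * Ring.inverse (g : PowerSeries S)

end RookToeplitz

open RookToeplitz Polynomial

/-! The proof is a transfer-matrix argument. Each term `a m` of an entry of the banded matrix is
regarded as an edge of weight `a m` joining a block row to a block column; parallel edges are
allowed, since in a circulant with n ≤ t several terms fall on the same entry. Only the number `p e`
of rooks on each edge matters: the number of placements with given `p` is a product of falling
factorials over block rows and of multinomial coefficients over block columns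
(`rookSum_eq_placementSum`, by induction on the rows).

Take the block rows from the bottom upwards. Each row meets a window of t+1 block columns; one
column enters with k free places and the oldest one leaves. The free places in the t columns that
are kept form a state in `G k t`. When the columns are filled in this order, the multinomials factor
into binomials that depend on the current state only, so the weight of a placement pattern is a
product of step weights, and `KMat` adds these up over the steps between two states (`KMat_apply`).
Hence the Toeplitz rook polynomial sums entries of Kⁿ from the state u to the states containing u
(`rookPoly_toeplitz`), and the circulant one is the trace of Kⁿ (`rookPoly_circulant`). Both cases
are treated together through a homomorphism `φ` from ℤ to ℤ or to ℤ/n that labels the columns.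

The permanent is the coefficient of x^(nk). The entries of K have degree at most k, and a step that
uses all k rows of its block never increases the total number of free places. So the x^k part of K
is block triangular for that total, with diagonal blocks Π_l (`coeff_pow_KMat`).

Finally ∑ Mⁿyⁿ inverts I − yM; its entries come from the adjugate and the trace series from Jacobi's
formula. -/

namespace RookToeplitz

/-! ### Rook polynomials as sums over partial injections -/

section Rook

variable {R m n : Type*} [CommRing R] [Fintype m] [DecidableEq m] [Fintype n]

/-- `f` is a partial injection with values in `T`. -/
def IsPlacement {m n : Type*} (T : Finset n) (f : m → Option n) : Prop :=
  (∀ i i' y, f i = some y → f i' = some y → i = i') ∧ ∀ i y, f i = some y → y ∈ T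

open Classical in
/-- The rook polynomial of the columns of `A` in `T`. -/
noncomputable def rookSum (A : m → n → R) (T : Finset n) : R[X] :=
  ∑ f : m → Option n, if IsPlacement T f then ∏ i, (f i).elim 1 (fun y => C (A i y) * X) else 0

theorem rookPoly_eq_rookSum [DecidableEq n] (A : Matrix m n R) : rookPoly A = rookSum (fun i j => A i j) Finset.univ := by
  classical
  have h1 : ∀ S : Finset m, C (∑ σ : (S ↪ n), ∏ i : S, A i (σ i)) * X ^ S.card =
      ∑ σ : (S ↪ n), ∏ i : S, (C (A i (σ i)) * X) := by
    intro S
    rw [map_sum, Finset.sum_mul]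
    refine Finset.sum_congr rfl fun σ _ => ?_
    rw [Finset.prod_mul_distrib, map_prod]
    simp
  rw [rookPoly, Finset.sum_congr rfl fun S _ => h1 S, Finset.sum_sigma', rookSum,
    ← Finset.sum_filter]
  refine Finset.sum_bij
    (fun p _ => fun x => if h : x ∈ p.1 then some (p.2 ⟨x, h⟩) else none) ?_ ?_ ?_ ?_
  · rintro ⟨S, σ⟩ -
    simp only [Finset.mem_filter, Finset.mem_univ, true_and, IsPlacement, implies_true, and_true]
    intro i i' y hi hi'
    split_ifs at hi hi' with h h'
    simp only [Option.some.injEq] at hi hi'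
    simpa using σ.injective (hi.trans hi'.symm)
  · rintro ⟨S, σ⟩ - ⟨S', σ'⟩ - h
    have hS : S = S' := by
      ext x
      have := congrFun h x
      by_cases h1 : x ∈ S <;> by_cases h2 : x ∈ S' <;> simp_all
    subst hS
    congr 1
    ext ⟨x, hx⟩
    simpa [hx] using congrFun h x
  · intro f hf
    simp only [Finset.mem_filter, Finset.mem_univ, true_and, IsPlacement, implies_true,
      and_true] at hf
    refine ⟨⟨Finset.univ.filter fun x => (f x).isSome,
      ⟨fun x => (f x.1).get (Finset.mem_filter.1 x.2).2, ?_⟩⟩, Finset.mem_univ _, ?_⟩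
    · intro x x' h
      refine Subtype.ext (hf x.1 x'.1 _ (Option.some_get (Finset.mem_filter.1 x.2).2).symm ?_)
      exact (Option.some_get (Finset.mem_filter.1 x'.2).2).symm.trans (congrArg some h.symm)
    · funext x
      by_cases h : (f x).isSome
      · simp only [Finset.mem_filter, Finset.mem_univ, true_and, h, dite_true]
        exact Option.some_get _
      · simp only [Finset.mem_filter, Finset.mem_univ, true_and, h]
        simpa using (Option.not_isSome_iff_eq_none.1 h).symm
  · rintro ⟨S, σ⟩ -
    simp only
    rw [← Finset.prod_subset (Finset.subset_univ S), ← Finset.prod_coe_sort S]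
    · refine Finset.prod_congr rfl fun i _ => ?_
      simp
    · intro x _ hx
      simp [hx]

theorem rookSum_of_isEmpty [IsEmpty m] (A : m → n → R) (T : Finset n) : rookSum A T = 1 := by
  simp [rookSum, IsPlacement]

theorem rookSum_reindex {m' : Type*} [Fintype m'] [DecidableEq m'] (e : m' ≃ m)
    (A : m → n → R) (T : Finset n) :
    rookSum (fun i j => A (e i) j) T = rookSum A T := by
  classical
  refine Fintype.sum_equiv (e.arrowCongr (Equiv.refl _)) _ _ fun f => ?_
  have h : IsPlacement T ((e.arrowCongr (Equiv.refl _)) f) ↔ IsPlacement T f := by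
    simp only [IsPlacement, Equiv.arrowCongr_apply, Equiv.coe_refl, Function.comp, id]
    constructor
    · rintro ⟨h1, h2⟩
      refine ⟨fun i i' y hi hi' => ?_, fun i y hi => h2 (e i) y (by simpa using hi)⟩
      exact e.injective (h1 (e i) (e i') y (by simpa using hi) (by simpa using hi'))
    · rintro ⟨h1, h2⟩
      exact ⟨fun i i' y hi hi' => e.symm.injective (h1 _ _ y hi hi'), fun i y hi => h2 _ y hi⟩
  simp only [h]
  split_ifs
  · refine Fintype.prod_equiv e _ _ fun i => ?_
    simp
  · rfl

/-- Expansion of a rook polynomial along a row. -/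
theorem rookSum_option [DecidableEq n] (A : Option m → n → R) (T : Finset n) :
    rookSum A T = rookSum (fun i j => A (some i) j) T +
      ∑ y ∈ T, C (A none y) * X * rookSum (fun i j => A (some i) j) (T.erase y) := by
  classical
  rw [rookSum, ← Equiv.piOptionEquivProd.symm.sum_comp, Fintype.sum_prod_type,
    Fintype.sum_option]
  congr 1
  · refine Finset.sum_congr rfl fun f _ => ?_
    have h : IsPlacement T (Equiv.piOptionEquivProd.symm ((none : Option n), f)) ↔
        IsPlacement T f := by
      simp [IsPlacement, Option.forall, Equiv.piOptionEquivProd]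
    simp only [h]
    simp [Fintype.prod_option, Equiv.piOptionEquivProd]
  · rw [← Finset.sum_subset (Finset.subset_univ T)]
    · refine Finset.sum_congr rfl fun y hy => ?_
      rw [rookSum, Finset.mul_sum]
      refine Finset.sum_congr rfl fun f _ => ?_
      have h : IsPlacement T (Equiv.piOptionEquivProd.symm (some y, f)) ↔
          IsPlacement (T.erase y) f := by
        simp only [IsPlacement, Option.forall, Equiv.piOptionEquivProd, Equiv.coe_fn_symm_mk,
          Option.some.injEq, Finset.mem_erase, reduceCtorEq, imp_false]
        constructor
        · rintro ⟨⟨h1, h2⟩, h3, h4⟩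
          refine ⟨fun i i' z hi hi' => h2 i |>.2 i' z hi hi', fun i z hi => ⟨?_, h4 i z hi⟩⟩
          rintro rfl
          exact (h2 i).1 z hi rfl
        · rintro ⟨h1, h2⟩
          refine ⟨⟨⟨fun _ _ _ => trivial, fun i z hz hi => ?_⟩, fun i => ⟨fun z hi hz => ?_,
            fun i' z hi hi' => h1 i i' z hi hi'⟩⟩, fun z hz => hz ▸ hy, fun i z hi => (h2 i z hi).2⟩
          · exact (h2 i z hi).1 hz.symm
          · exact (h2 i z hi).1 hz.symm
      simp only [h]
      split_ifs
      · simp [Fintype.prod_option, Equiv.piOptionEquivProd]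
      · simp
    · intro y _ hy
      refine Finset.sum_eq_zero fun f _ => if_neg fun h => hy ?_
      exact h.2 none y rfl

/-- The permanent is the top coefficient of the rook polynomial. -/
theorem coeff_rookPoly_card (A : Matrix m m R) :
    (rookPoly A).coeff (Fintype.card m) = A.permanent := by
  classical
  rw [rookPoly, finsetSum_coeff, Finset.sum_eq_single Finset.univ]
  -- `Matrix.permanent` multiplies entries at `(σ i, i)`, the rook polynomial those at `(i, σ i)`;
  -- hence the transpose.
  · rw [coeff_C_mul, Finset.card_univ, coeff_X_pow, if_pos rfl, mul_one,
      ← Matrix.permanent_transpose, Matrix.permanent]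
    refine Fintype.sum_bijective
      (fun σ : ((Finset.univ : Finset m) ↪ m) => Equiv.ofBijective (fun i => σ ⟨i, Finset.mem_univ i⟩)
        (Finite.injective_iff_bijective.1 fun i j h => by simpa using σ.injective h)) ?_ _ _ ?_
    · constructor
      · intro σ τ h
        ext ⟨i, hi⟩
        simpa using Equiv.congr_fun h i
      · intro τ
        refine ⟨⟨fun i => τ i, fun i j h => Subtype.ext (τ.injective h)⟩, ?_⟩
        exact Equiv.ext fun i => rfl
    · intro σ
      simp only [Matrix.transpose_apply, Equiv.ofBijective_apply]
      exact Fintype.prod_equiv (Equiv.subtypeUnivEquiv Finset.mem_univ) _ _ fun i => rfl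
  · intro S _ hS
    rw [coeff_C_mul, coeff_X_pow, if_neg, mul_zero]
    intro h
    exact hS ((Finset.card_eq_iff_eq_univ S).1 h.symm)
  · simp

end Rook

/-! ### Rook polynomials of block matrices as sums over edge multiplicities -/

/-- An injection of m points into n+1 either misses the added point or sends exactly one of the m
points to it. -/
theorem succ_descFactorial_eq_add (n m : ℕ) :
    (n + 1).descFactorial m = n.descFactorial m + m * n.descFactorial (m - 1) := by
  cases m with
  | zero => simp
  | succ k =>
    rw [Nat.succ_descFactorial_succ, Nat.descFactorial_succ, Nat.add_sub_cancel, ← add_mul]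
    rcases le_or_gt k n with h | h
    · congr 1
      omega
    · rw [Nat.descFactorial_eq_zero_iff_lt.2 h, mul_zero, mul_zero]

theorem descFactorial_mul_sub (n a b : ℕ) :
    n.descFactorial a * (n - a).descFactorial b = n.descFactorial (a + b) := by
  induction b with
  | zero => simp
  | succ b ih =>
    rw [Nat.descFactorial_succ, mul_left_comm, ih, ← add_assoc, Nat.descFactorial_succ,
      Nat.sub_sub]

section Contingency

variable {E I J : Type*} [Fintype E] [DecidableEq E] [Fintype I] [DecidableEq I] [DecidableEq J]

/-- The edges in column `c` whose slot is less than `i`. -/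
def edgesBefore (col : E → J) (slot : E → ℕ) (c : J) (i : ℕ) : Finset E :=
  Finset.univ.filter fun e => col e = c ∧ slot e < i

/-- The number of ways to hand out `d c` places of each column `c` to its edges, where the edge
`e` gets `p e` places and the edges are served in the order of their slots. -/
def colMult (col : E → J) (slot : E → ℕ) (d : J → ℕ) (p : E → ℕ) : ℕ :=
  ∏ e, (d (col e) - ∑ e' ∈ edgesBefore col slot (col e) (slot e), p e').choose (p e)

omit [DecidableEq E] in
theorem notMem_edgesBefore {col : E → J} {slot : E → ℕ} (e : E) :
    e ∉ edgesBefore col slot (col e) (slot e) := by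
  simp [edgesBefore]

theorem edgesBefore_succ {col : E → J} {slot : E → ℕ}
    (h : ∀ e e', col e = col e' → slot e = slot e' → e = e') (e : E) :
    edgesBefore col slot (col e) (slot e + 1) =
      insert e (edgesBefore col slot (col e) (slot e)) := by
  ext e'
  simp only [edgesBefore, Finset.mem_filter, Finset.mem_univ, true_and, Finset.mem_insert]
  constructor
  · rintro ⟨h1, h2⟩
    rcases Nat.lt_succ_iff_lt_or_eq.1 h2 with h3 | h3
    · exact Or.inr ⟨h1, h3⟩
    · exact Or.inl (h _ _ h1 h3)
  · rintro (rfl | ⟨h1, h2⟩)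
    · exact ⟨rfl, Nat.lt_succ_self _⟩
    · exact ⟨h1, h2.trans (Nat.lt_succ_self _)⟩

omit [DecidableEq E] in
theorem edgesBefore_succ_of_forall_ne {col : E → J} {slot : E → ℕ} {c : J} {i : ℕ}
    (h : ∀ e, col e = c → slot e ≠ i) :
    edgesBefore col slot c (i + 1) = edgesBefore col slot c i := by
  ext e'
  simp only [edgesBefore, Finset.mem_filter, Finset.mem_univ, true_and]
  refine and_congr_right fun h1 => ?_
  have := h e' h1
  omega

/-- Within a column the products p! · C(d − earlier, p) telescope to one falling factorial. This
removes the dependence on the serving order; the hypothesis says that no two edges of a column share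
a slot. -/
theorem prod_factorial_mul_colMult {col : E → J} {slot : E → ℕ}
    (h : ∀ e e', col e = col e' → slot e = slot e' → e = e') (d : J → ℕ) (p : E → ℕ) :
    (∏ e, (p e).factorial) * colMult col slot d p =
      ∏ c ∈ Finset.univ.image col, (d c).descFactorial (∑ e with col e = c, p e) := by
  have key : ∀ (c : J) (N : ℕ), ∏ e ∈ edgesBefore col slot c N,
      (d c - ∑ e' ∈ edgesBefore col slot c (slot e), p e').descFactorial (p e) =
        (d c).descFactorial (∑ e ∈ edgesBefore col slot c N, p e) := by
    intro c N
    induction N with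
    | zero => simp [edgesBefore]
    | succ N ih =>
      by_cases hN : ∃ e, col e = c ∧ slot e = N
      · obtain ⟨e, rfl, rfl⟩ := hN
        rw [edgesBefore_succ h, Finset.prod_insert (notMem_edgesBefore e),
          Finset.sum_insert (notMem_edgesBefore e), ih, mul_comm, descFactorial_mul_sub, add_comm]
      · rw [edgesBefore_succ_of_forall_ne fun e he hs => hN ⟨e, he, hs⟩, ih]
  rw [colMult, ← Finset.prod_mul_distrib, ← Finset.prod_fiberwise_of_maps_to
    (fun e _ => Finset.mem_image_of_mem col (Finset.mem_univ e))]
  refine Finset.prod_congr rfl fun c _ => ?_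
  have hall : (Finset.univ.filter fun e => col e = c) =
      edgesBefore col slot c (Finset.univ.sup slot + 1) := by
    ext e
    simp only [edgesBefore, Finset.mem_filter, Finset.mem_univ, true_and, iff_self_and]
    exact fun _ => Nat.lt_succ_of_le (Finset.le_sup (Finset.mem_univ e))
  rw [hall, ← key]
  refine Finset.prod_congr rfl fun e he => ?_
  rw [← Nat.descFactorial_eq_factorial_mul_choose, (Finset.mem_filter.1 he).2.1]

theorem sum_add_single {K : Type*} [DecidableEq K] (f : E → K) (p : E → ℕ) (e : E) (c : K) :
    ∑ e' with f e' = c, (p + Pi.single e 1 : E → ℕ) e' =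
      (∑ e' with f e' = c, p e') + if f e = c then 1 else 0 := by
  simp only [Pi.add_apply, Finset.sum_add_distrib]
  congr 1
  simp [Finset.sum_pi_single']

/-- After multiplication by the factorials this is (N)_{s+1} = N · (N−1)_s in the column of `e`: one
of the places on `e` is singled out and its actual column chosen. -/
theorem succ_mul_colMult {col : E → J} {slot : E → ℕ}
    (h : ∀ e e', col e = col e' → slot e = slot e' → e = e') (d : J → ℕ) (p : E → ℕ) (e : E) :
    (p e + 1) * colMult col slot d (p + Pi.single e 1) =
      d (col e) * colMult col slot (d - Pi.single (col e) 1) p := by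
  have hpos : 0 < ∏ e, (p e).factorial := Finset.prod_pos fun e _ => Nat.factorial_pos _
  refine Nat.eq_of_mul_eq_mul_left hpos ?_
  have h1 : (∏ e, (p e).factorial) * (p e + 1) = ∏ e', ((p + Pi.single e 1 : E → ℕ) e').factorial := by
    conv_rhs => rw [← Finset.mul_prod_erase _ _ (Finset.mem_univ e)]
    rw [← Finset.mul_prod_erase _ _ (Finset.mem_univ e), mul_right_comm]
    congr 1
    · simp [Nat.factorial_succ, mul_comm]
    · refine Finset.prod_congr rfl fun e' he' => ?_
      simp [Finset.ne_of_mem_erase he']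
  rw [← mul_assoc, h1, prod_factorial_mul_colMult h, mul_left_comm, prod_factorial_mul_colMult h]
  have hmem := Finset.mem_image_of_mem col (Finset.mem_univ e)
  rw [← Finset.mul_prod_erase _ _ hmem, ← Finset.mul_prod_erase _ _ hmem, ← mul_assoc]
  congr 1
  · rw [sum_add_single, if_pos rfl]
    simp only [Pi.sub_apply, Pi.single_eq_same]
    cases d (col e) with
    | zero => simp
    | succ x => rw [Nat.succ_descFactorial_succ, Nat.add_sub_cancel]
  · refine Finset.prod_congr rfl fun c hc => ?_
    have hc' := Finset.ne_of_mem_erase hc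
    rw [sum_add_single, if_neg hc'.symm, add_zero]
    simp [hc']

/-- The number of rook placements with `p e` rooks on the edge `e`, for rows of multiplicities `c`
and columns of multiplicities `d`. -/
def placements (row : E → I) (col : E → J) (slot : E → ℕ) (c : I → ℕ) (d : J → ℕ) (p : E → ℕ) : ℕ :=
  (∏ i, (c i).descFactorial (∑ e with row e = i, p e)) * colMult col slot d p

/-- The recursion for one more row in class `i`: the row is empty, or its rook lies on some edge `e`
and occupies one of the `d (col e)` columns. With m the total of `p` over the edges at `i`, it is
(c+1)_m = (c)_m + m · (c)_{m−1}, where m is split into the shares `p e`. -/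
theorem placements_add_single (row : E → I) {col : E → J} {slot : E → ℕ}
    (h : ∀ e e', col e = col e' → slot e = slot e' → e = e') (c : I → ℕ) (d : J → ℕ) (p : E → ℕ)
    (i : I) :
    placements row col slot (c + Pi.single i 1) d p = placements row col slot c d p +
      ∑ e with row e = i, if p e = 0 then 0 else
        d (col e) * placements row col slot c (d - Pi.single (col e) 1) (p - Pi.single e 1) := by
  have h1 : ∀ e, row e = i → (if p e = 0 then 0 else
      d (col e) * placements row col slot c (d - Pi.single (col e) 1) (p - Pi.single e 1)) =
      p e * ((c i).descFactorial ((∑ e with row e = i, p e) - 1) *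
        ∏ j ∈ Finset.univ.erase i, (c j).descFactorial (∑ e with row e = j, p e)) *
        colMult col slot d p := by
    rintro e rfl
    split_ifs with hp
    · simp [hp]
    · obtain ⟨q, rfl⟩ : ∃ q : E → ℕ, p = q + Pi.single e 1 := by
        refine ⟨p - Pi.single e 1, ?_⟩
        ext e'
        by_cases he : e' = e
        · subst he
          simp
          omega
        · simp [he]
      have hq : q + Pi.single e 1 - Pi.single e 1 = q := by ext; simp
      rw [hq, placements, mul_left_comm, ← succ_mul_colMult h]
      rw [← Finset.mul_prod_erase _ _ (Finset.mem_univ (row e)), sum_add_single, if_pos rfl,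
        Nat.add_sub_cancel]
      have : ∏ x ∈ Finset.univ.erase (row e), (c x).descFactorial (∑ e with row e = x, q e) =
          ∏ j ∈ Finset.univ.erase (row e),
            (c j).descFactorial (∑ e' with row e' = j, (q + Pi.single e 1 : E → ℕ) e') := by
        refine Finset.prod_congr rfl fun j hj => ?_
        rw [sum_add_single, if_neg (Finset.ne_of_mem_erase hj).symm, add_zero]
      rw [this]
      simp only [Pi.add_apply, Pi.single_eq_same]
      ring
  rw [Finset.sum_congr rfl fun e he => h1 e (Finset.mem_filter.1 he).2, ← Finset.sum_mul,
    ← Finset.sum_mul, placements, placements, ← add_mul,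
    ← Finset.mul_prod_erase _ _ (Finset.mem_univ i),
    ← Finset.mul_prod_erase _ (fun j => (c j).descFactorial _) (Finset.mem_univ i), ← mul_assoc,
    ← add_mul, ← succ_descFactorial_eq_add]
  congr 2
  · simp
  · refine Finset.prod_congr rfl fun j hj => ?_
    simp [Finset.ne_of_mem_erase hj]

omit [DecidableEq E] in
theorem placements_eq_zero {row : E → I} {col : E → J} {slot : E → ℕ} {c : I → ℕ} {d : J → ℕ}
    {p : E → ℕ} (e : E) (he : c (row e) < p e) : placements row col slot c d p = 0 := by
  rw [placements, Finset.prod_eq_zero (Finset.mem_univ (row e)), zero_mul]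
  refine Nat.descFactorial_eq_zero_iff_lt.2 (he.trans_le ?_)
  exact Finset.single_le_sum (f := p) (fun _ _ => Nat.zero_le _) (by simp)

/-- The generating function of the numbers of placements by edge weights; the parameter `B`
bounds the number of rooks on an edge. -/
def placementSum {S : Type*} [CommRing S] (row : E → I) (col : E → J) (slot : E → ℕ) (w : E → S)
    (B : ℕ) (c : I → ℕ) (d : J → ℕ) : S :=
  ∑ p ∈ Fintype.piFinset fun _ : E => Finset.range (B + 1),
    (placements row col slot c d p : S) * ∏ e, w e ^ p e

/-- The substitution p ↦ p − 1 at `e` maps the box onto the part with p e ≠ B; the hypothesis on `g`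
makes the missing face harmless. -/
theorem sum_shift {S : Type*} [CommRing S] (w : E → S) (B : ℕ) (g : (E → ℕ) → S) (e : E)
    (hg : ∀ p, p e = B → g p = 0) :
    ∑ p ∈ Fintype.piFinset fun _ : E => Finset.range (B + 1),
      (if p e = 0 then 0 else g (p - Pi.single e 1)) * ∏ e, w e ^ p e =
    w e * ∑ p ∈ Fintype.piFinset fun _ : E => Finset.range (B + 1), g p * ∏ e, w e ^ p e := by
  have h1 : ∑ p ∈ (Fintype.piFinset fun _ : E => Finset.range (B + 1)) with p e ≠ 0,
      g (p - Pi.single e 1) * ∏ e, w e ^ p e =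
    ∑ p ∈ (Fintype.piFinset fun _ : E => Finset.range (B + 1)) with p e ≠ B,
      w e * (g p * ∏ e, w e ^ p e) := by
    refine Finset.sum_nbij' (fun p => p - Pi.single e 1) (fun p => p + Pi.single e 1) ?_ ?_ ?_ ?_ ?_
    · intro p hp
      simp only [Finset.mem_filter, Fintype.mem_piFinset, Finset.mem_range, Pi.sub_apply] at hp ⊢
      refine ⟨fun x => lt_of_le_of_lt (Nat.sub_le _ _) (hp.1 x), ?_⟩
      have := hp.1 e
      simp only [Pi.single_eq_same]
      omega
    · intro p hp
      simp only [Finset.mem_filter, Fintype.mem_piFinset, Finset.mem_range, Pi.add_apply] at hp ⊢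
      refine ⟨fun x => ?_, by simp⟩
      by_cases hx : x = e
      · subst hx
        have := hp.1 x
        simp only [Pi.single_eq_same]
        omega
      · simpa [hx] using hp.1 x
    · intro p hp
      simp only [Finset.mem_filter] at hp
      ext x
      by_cases hx : x = e
      · subst hx
        simp
        omega
      · simp [hx]
    · intro p _
      ext x
      simp
    · intro p hp
      have hp' := (Finset.mem_filter.1 hp).2
      rw [mul_left_comm]
      congr 1
      conv_rhs => rw [← Finset.mul_prod_erase _ _ (Finset.mem_univ e), ← mul_assoc, ← pow_succ']
      rw [← Finset.mul_prod_erase _ _ (Finset.mem_univ e)]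
      congr 1
      · congr 1
        simp
        omega
      · refine Finset.prod_congr rfl fun x hx => ?_
        simp [Finset.ne_of_mem_erase hx]
  rw [Finset.sum_filter, Finset.sum_filter] at h1
  rw [Finset.mul_sum]
  refine Eq.trans (Finset.sum_congr rfl fun p _ => ?_) (h1.trans (Finset.sum_congr rfl fun p _ => ?_))
  · split_ifs <;> simp_all
  · split_ifs with hp
    · rfl
    · simp [hg p (not_not.1 hp)]

/-- The analogue of `rookSum_option` for edge multiplicities. Since `c i < B`, no term is lost at
the upper boundary of the box. -/
theorem placementSum_add_single {S : Type*} [CommRing S] (row : E → I) {col : E → J} {slot : E → ℕ}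
    (h : ∀ e e', col e = col e' → slot e = slot e' → e = e') (w : E → S) (B : ℕ) (c : I → ℕ)
    (d : J → ℕ) (i : I) (hc : c i < B) :
    placementSum row col slot w B (c + Pi.single i 1) d = placementSum row col slot w B c d +
      ∑ e with row e = i, d (col e) *
        (w e * placementSum row col slot w B c (d - Pi.single (col e) 1)) := by
  have h1 : ∀ e, row e = i → d (col e) *
      (w e * placementSum row col slot w B c (d - Pi.single (col e) 1)) =
      ∑ p ∈ Fintype.piFinset fun _ : E => Finset.range (B + 1),
        ((if p e = 0 then 0 else d (col e) * placements row col slot c (d - Pi.single (col e) 1)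
          (p - Pi.single e 1) : ℕ) : S) * ∏ e, w e ^ p e := by
    rintro e rfl
    have := sum_shift w B
      (fun p => ((d (col e) * placements row col slot c (d - Pi.single (col e) 1) p : ℕ) : S)) e
      (fun p hp => by rw [placements_eq_zero e (hp ▸ hc), mul_zero, Nat.cast_zero])
    rw [placementSum, mul_left_comm, Finset.mul_sum]
    simp only [Nat.cast_mul, mul_assoc] at this ⊢
    rw [← this]
    refine Finset.sum_congr rfl fun p _ => ?_
    split_ifs <;> simp [mul_assoc]
  rw [Finset.sum_congr rfl fun e he => h1 e (Finset.mem_filter.1 he).2, Finset.sum_comm,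
    placementSum, placementSum, ← Finset.sum_add_distrib]
  refine Finset.sum_congr rfl fun p _ => ?_
  rw [placements_add_single row h, Nat.cast_add, add_mul, Nat.cast_sum, Finset.sum_mul]

theorem placementSum_zero {S : Type*} [CommRing S] (row : E → I) (col : E → J) (slot : E → ℕ)
    (w : E → S) (B : ℕ) (d : J → ℕ) : placementSum row col slot w B 0 d = 1 := by
  rw [placementSum, Finset.sum_eq_single 0]
  · simp [placements, colMult]
  · intro p _ hp
    obtain ⟨e, he⟩ := Function.ne_iff.1 hp
    rw [placements_eq_zero e (Nat.pos_of_ne_zero he), Nat.cast_zero, zero_mul]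
  · simp

/-- The rook polynomial of a matrix whose entry at `(x, y)` is the sum of the weights of the edges
joining the class `ρ x` of the row `x` to the class `κ y` of the column `y`. -/
theorem rookSum_eq_placementSum {R n : Type*} [CommRing R] [Fintype n] [DecidableEq n]
    (row : E → I) {col : E → J} {slot : E → ℕ}
    (h : ∀ e e', col e = col e' → slot e = slot e' → e = e') (w : E → R) (κ : n → J) (B : ℕ)
    (m : Type*) [Fintype m] [DecidableEq m] (ρ : m → I) (hB : Fintype.card m ≤ B) (T : Finset n) :
    rookSum (fun (x : m) y => ∑ e with row e = ρ x ∧ col e = κ y, w e) T =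
      placementSum row col slot (fun e => C (w e) * X) B
        (fun i => (Finset.univ.filter fun x => ρ x = i).card)
        (fun j => (T.filter fun y => κ y = j).card) := by
  suffices hm : ∀ (ρ : m → I), Fintype.card m ≤ B → ∀ T : Finset n,
      rookSum (fun (x : m) y => ∑ e with row e = ρ x ∧ col e = κ y, w e) T =
      placementSum row col slot (fun e => C (w e) * X) B
        (fun i => (Finset.univ.filter fun x => ρ x = i).card)
        (fun j => (T.filter fun y => κ y = j).card) from hm ρ hB T
  revert ‹DecidableEq m›
  refine Fintype.induction_empty_option (P := fun m _ => ∀ [DecidableEq m] (ρ : m → I),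
      Fintype.card m ≤ B → ∀ T : Finset n,
      rookSum (fun (x : m) y => ∑ e with row e = ρ x ∧ col e = κ y, w e) T =
      placementSum row col slot (fun e => C (w e) * X) B
        (fun i => (Finset.univ.filter fun x => ρ x = i).card)
        (fun j => (T.filter fun y => κ y = j).card)) ?_ ?_ ?_ m
  · intro α β hβ e ih _ ρ hB T
    classical
    let _ : Fintype α := Fintype.ofEquiv β e.symm
    rw [← rookSum_reindex e, ih (fun x => ρ (e x)) ((Fintype.card_congr e).trans_le hB) T]
    congr 1
    ext i
    exact Finset.card_bij (fun x _ => e x) (by simp) (by simp)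
      fun y hy => ⟨e.symm y, by simpa using hy, by simp⟩
  · intro _ ρ _ T
    rw [rookSum_of_isEmpty]
    exact (placementSum_zero row col slot _ B _).symm
  · intro α _ ih hdec ρ hB T
    classical
    obtain rfl : hdec = Option.instDecidableEq := Subsingleton.elim _ _
    rw [Fintype.card_option] at hB
    have hih := ih (fun x => ρ (some x)) (Nat.le_of_succ_le hB)
    have hc : (fun i => (Finset.univ.filter fun x : Option α => ρ x = i).card) =
        (fun i => (Finset.univ.filter fun x : α => ρ (some x) = i).card) +
          Pi.single (ρ none) 1 := by
      ext i
      simp only [Finset.card_filter, Fintype.sum_option, Pi.add_apply, Pi.single_apply, add_comm,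
        eq_comm]
    have hd : ∀ y ∈ T, (fun j => ((T.erase y).filter fun y => κ y = j).card) =
        (fun j => (T.filter fun y => κ y = j).card) - Pi.single (κ y) 1 := by
      intro y hy
      ext j
      rw [Finset.filter_erase]
      by_cases hj : κ y = j
      · subst hj
        rw [Finset.card_erase_of_mem (by simp [hy])]
        simp
      · rw [Finset.erase_eq_of_notMem (by simp [hj])]
        simp [Ne.symm hj]
    rw [rookSum_option, hc, placementSum_add_single row h, hih]
    · congr 1
      have h2 : ∀ y ∈ T, C (∑ e with row e = ρ none ∧ col e = κ y, w e) * X *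
          rookSum (fun x y => ∑ e with row e = ρ (some x) ∧ col e = κ y, w e) (T.erase y) =
          ∑ e with row e = ρ none, if κ y = col e then C (w e) * X *
            placementSum row col slot (fun e => C (w e) * X) B
              (fun i => (Finset.univ.filter fun x : α => ρ (some x) = i).card)
              ((fun j => (T.filter fun y => κ y = j).card) - Pi.single (col e) 1) else 0 := by
        intro y hy
        rw [hih, hd y hy, map_sum, Finset.sum_mul, Finset.sum_mul, ← Finset.filter_filter,
          Finset.sum_filter]
        refine Finset.sum_congr rfl fun e _ => ?_
        by_cases he : col e = κ y
        · simp [he]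
        · simp [he, Ne.symm he]
      rw [Finset.sum_congr rfl h2, Finset.sum_comm]
      refine Finset.sum_congr rfl fun e _ => ?_
      -- For a fixed edge all columns of its class contribute equally, which produces the factor `d
      -- (col e)`.
      rw [← Finset.sum_filter, Finset.sum_const, nsmul_eq_mul]
    · exact lt_of_le_of_lt (Finset.card_filter_le _ _) (Nat.lt_of_succ_le hB)

end Contingency

/-! ### The transfer matrices as sums over single steps -/

section Step

variable {S : Type*} [CommRing S] {k t : ℕ}

/-- The number of free places in each column of the window, from the new column to the oldest. -/
def avail (α : G k t) : Fin (t + 1) → ℕ := Fin.cons (α := fun _ => ℕ) k fun i => (α i : ℕ)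

@[simp] theorem avail_zero (α : G k t) : avail α 0 = k := rfl

@[simp] theorem avail_succ (α : G k t) (i : Fin t) : avail α i.succ = α i := rfl

theorem avail_le (α : G k t) (i : Fin (t + 1)) : avail α i ≤ k := by
  refine Fin.cases le_rfl (fun j => ?_) i
  exact Nat.le_of_lt_succ (α j).2

theorem sum_avail (α : G k t) : ∑ i, avail α i = k + ∑ i, (α i : ℕ) := by
  simp [Fin.sum_univ_succ]

/-- The state after `q i` places of column `i` of the window are taken. -/
def step (α : G k t) (q : Fin (t + 1) → Fin (k + 1)) : G k t :=
  fun i => ⟨avail α i.castSucc - q i.castSucc,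
    Nat.lt_succ_of_le ((Nat.sub_le _ _).trans (avail_le α _))⟩

/-- The weight of a step. -/
def stepWeight (a : Fin (t + 1) → S) (α : G k t) (q : Fin (t + 1) → Fin (k + 1)) : S :=
  ((k.descFactorial (∑ i, (q i : ℕ)) * ∏ i, (avail α i).choose (q i) : ℕ) : S) *
    ∏ i, a i ^ (q i : ℕ)

theorem stepWeight_eq_zero (a : Fin (t + 1) → S) (α : G k t) {q : Fin (t + 1) → Fin (k + 1)}
    (i : Fin (t + 1)) (h : avail α i < q i) : stepWeight a α q = 0 := by
  rw [stepWeight, Finset.prod_eq_zero (Finset.mem_univ i) (Nat.choose_eq_zero_of_lt h)]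
  simp

theorem stepWeight_eq_zero_of_lt_sum (a : Fin (t + 1) → S) (α : G k t)
    {q : Fin (t + 1) → Fin (k + 1)} (h : k < ∑ i, (q i : ℕ)) : stepWeight a α q = 0 := by
  rw [stepWeight, Nat.descFactorial_eq_zero_iff_lt.2 h]
  simp

/-- The places taken between `α` and `β` from the columns which remain in the window. -/
def taken (α β : G k t) : Fin t → Fin (k + 1) :=
  fun i => ⟨avail α i.castSucc - β i, Nat.lt_succ_of_le ((Nat.sub_le _ _).trans (avail_le α _))⟩

theorem sum_step {F : (Fin (t + 1) → Fin (k + 1)) → S} {α : G k t} (β : G k t)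
    (hF : ∀ q i, avail α i < (q i : ℕ) → F q = 0) :
    ∑ q, (if step α q = β then F q else 0) =
      if ∀ i, (β i : ℕ) ≤ avail α i.castSucc then
        ∑ d : Fin (k + 1), F (Fin.snoc (α := fun _ => Fin (k + 1)) (taken α β) d) else 0 := by
  rw [← (Fin.snocEquiv fun _ => Fin (k + 1)).sum_comp, Fintype.sum_prod_type]
  have hstep : ∀ d : Fin (k + 1),
      step α (Fin.snoc (α := fun _ => Fin (k + 1)) (taken α β) d) = β ↔
        ∀ i, (β i : ℕ) ≤ avail α i.castSucc := by
    intro d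
    simp only [funext_iff, step, Fin.ext_iff, Fin.snoc_castSucc, taken]
    exact forall_congr' fun i => by omega
  have h1 : ∀ d : Fin (k + 1), ∑ p : Fin t → Fin (k + 1),
      (if step α (Fin.snocEquiv (fun _ => Fin (k + 1)) (d, p)) = β then
        F (Fin.snocEquiv (fun _ => Fin (k + 1)) (d, p)) else 0) =
      if ∀ i, (β i : ℕ) ≤ avail α i.castSucc then
        F (Fin.snoc (α := fun _ => Fin (k + 1)) (taken α β) d) else 0 := by
    intro d
    rw [Finset.sum_eq_single (taken α β)]
    · simp only [Fin.snocEquiv, Equiv.coe_fn_mk, hstep]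
    · intro p _ hp
      obtain ⟨i, hi⟩ := Function.ne_iff.1 hp
      refine ite_eq_right_iff.2 fun h => ?_
      by_cases hlt : avail α i.castSucc < p i
      · refine hF _ i.castSucc ?_
        simpa [Fin.snocEquiv] using hlt
      · exfalso
        have := congrFun h i
        simp only [Fin.snocEquiv, Equiv.coe_fn_mk, step, Fin.snoc_castSucc, Fin.ext_iff] at this
        apply hi
        simp only [Fin.ext_iff, taken]
        omega
    · simp
  rw [Finset.sum_congr rfl fun d _ => h1 d]
  split_ifs <;> simp

theorem avail_castSucc_succ (α : G k (t + 1)) (i : Fin t) :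
    avail α i.succ.castSucc = α i.castSucc := by
  rw [← Fin.succ_castSucc, avail_succ]

theorem avail_last (α : G k (t + 1)) : avail α (Fin.last (t + 1)) = α (Fin.last t) := by
  rw [← Fin.succ_last, avail_succ]

theorem taken_zero (α β : G k (t + 1)) : (taken α β 0 : ℕ) = k - β 0 := rfl

theorem taken_succ (α β : G k (t + 1)) (i : Fin t) : (taken α β i.succ : ℕ) = usedOld α β i := by
  simp only [taken, usedOld, avail_castSucc_succ]

theorem forall_le_avail_iff (α β : G k (t + 1)) :
    (∀ i : Fin (t + 1), (β i : ℕ) ≤ avail α i.castSucc) ↔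
      ∀ i : Fin t, β i.succ ≤ α i.castSucc := by
  rw [Fin.forall_fin_succ]
  simp only [avail_castSucc_succ, Fin.castSucc_zero, avail_zero, Fin.le_def, and_iff_right_iff_imp]
  exact fun _ => Nat.le_of_lt_succ (β 0).2

theorem sum_snoc_taken (α β : G k (t + 1)) (d : Fin (k + 1)) :
    ∑ i, (Fin.snoc (α := fun _ => Fin (k + 1)) (taken α β) d i : ℕ) = d + usedAll α β := by
  have := Nat.le_of_lt_succ (β 0).2
  rw [Fin.sum_univ_castSucc, Fin.sum_univ_succ]
  simp only [Fin.snoc_castSucc, Fin.snoc_last, taken_zero, taken_succ, usedAll]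
  omega

theorem stepWeight_snoc_taken (a : Fin (t + 2) → S) (α β : G k (t + 1)) (d : Fin (k + 1)) :
    stepWeight a α (Fin.snoc (α := fun _ => Fin (k + 1)) (taken α β) d) =
      ((∏ i : Fin t, (α i.castSucc : ℕ).choose (usedOld α β i) : ℕ) : S)
          * ((k.choose (usedAll α β - ∑ i, usedOld α β i) : ℕ) : S)
          * a 0 ^ (usedAll α β - ∑ i, usedOld α β i)
          * (∏ i : Fin t, a i.succ.castSucc ^ usedOld α β i)
          * ((((d + usedAll α β).factorial * k.choose (d + usedAll α β)
                * (α (Fin.last t) : ℕ).choose d : ℕ) : S) * a (Fin.last (t + 1)) ^ (d : ℕ)) := by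
  have h0 : usedAll α β - ∑ i, usedOld α β i = k - β 0 := by
    have := Nat.le_of_lt_succ (β 0).2
    rw [usedAll]
    omega
  have h1 : Fin.snoc (α := fun _ => Fin (k + 1)) (taken α β) d 0 = taken α β 0 :=
    Fin.snoc_castSucc (α := fun _ => Fin (k + 1)) d (taken α β) 0
  rw [stepWeight, sum_snoc_taken, h0, Nat.descFactorial_eq_factorial_mul_choose,
    Fin.prod_univ_castSucc, Fin.prod_univ_castSucc (fun i => a i ^ _), Fin.prod_univ_succ,
    Fin.prod_univ_succ (fun i : Fin (t + 1) => a i.castSucc ^ _)]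
  simp only [Fin.snoc_castSucc, Fin.snoc_last, Fin.castSucc_zero, h1, taken_zero, taken_succ,
    avail_last, avail_castSucc_succ, avail_zero]
  push_cast
  ring

/-- In the closed formula, p_i is what is taken from a kept old column, v − ∑ p_i from the new one
and d from the departing one; (d+v)! C(k, d+v) is the falling factorial assigning rows to the d+v
rooks. -/
theorem KMat_apply (a : Fin (t + 1) → S) (α β : G k t) :
    KMat k t a α β = ∑ q, if step α q = β then stepWeight a α q else 0 := by
  rw [sum_step β fun q i h => stepWeight_eq_zero a α i h]
  cases t with
  | zero =>
    rw [if_pos fun i => i.elim0, KMat, Matrix.of_apply, Finset.sum_range]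
    refine Finset.sum_congr rfl fun d _ => ?_
    simp [stepWeight, Nat.descFactorial_eq_factorial_mul_choose, Fin.snoc]
    ring
  | succ t =>
    rw [KMat, Matrix.of_apply]
    simp only [forall_le_avail_iff]
    by_cases h1 : ∀ i : Fin t, β i.succ ≤ α i.castSucc
    · simp only [h1, implies_true, true_and, if_true]
      by_cases h2 : ∑ i, usedOld α β i ≤ (β 0 : ℕ)
      · rw [if_pos h2]
        simp only [stepWeight_snoc_taken]
        rw [← Finset.mul_sum]
        congr 1
        rw [Fin.sum_univ_eq_sum_range (fun d => (((d + usedAll α β).factorial *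
          k.choose (d + usedAll α β) * (α (Fin.last t) : ℕ).choose d : ℕ) : S) *
            a (Fin.last (t + 1)) ^ d)]
        refine Finset.sum_subset ?_ ?_
        · intro d
          simp only [Finset.mem_range]
          omega
        · intro d _ hd
          simp only [Finset.mem_range, not_lt] at hd
          -- Beyond the minimum bounding the range of `d`, one of the two binomials vanishes.
          have : (α (Fin.last t) : ℕ) < d ∨ k < d + usedAll α β := by omega
          rcases this with h | h <;> simp [Nat.choose_eq_zero_of_lt h]
      · rw [if_neg h2]
        refine (Finset.sum_eq_zero fun d _ => stepWeight_eq_zero_of_lt_sum a α ?_).symm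
        rw [sum_snoc_taken, usedAll]
        omega
    · simp [h1]

/-- The entering column brings k free places and a full step uses k, so the total drops exactly by
what is left free in the departing column. -/
theorem sum_le_of_step_eq {α β : G k t} {q : Fin (t + 1) → Fin (k + 1)} (h : step α q = β)
    (hq : ∀ i, (q i : ℕ) ≤ avail α i) (hk : ∑ i, (q i : ℕ) = k) :
    ∑ i, (β i : ℕ) + (avail α (Fin.last t) - q (Fin.last t)) = ∑ i, (α i : ℕ) := by
  have h1 : ∑ i, (avail α i - q i) = ∑ i, (α i : ℕ) := by
    rw [Finset.sum_tsub_distrib _ fun i _ => hq i, sum_avail, hk, Nat.add_sub_cancel_left]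
  rw [← h1, Fin.sum_univ_castSucc, ← h]
  rfl

theorem PiMat_apply (a : Fin (t + 1) → S) {r : ℕ} (α β : GSum k r t) :
    PiMat k r t a α β = ∑ q, if step α.1 q = β.1 then
      if ∑ i, (q i : ℕ) = k then stepWeight a α.1 q else 0 else 0 := by
  rw [sum_step β.1 fun q i h => ite_eq_right_iff.2 fun _ => stepWeight_eq_zero a α.1 i h]
  cases t with
  | zero =>
    rw [if_pos fun i => i.elim0, PiMat, Matrix.of_apply, Finset.sum_eq_single (Fin.last k)]
    · simp [stepWeight, Fin.snoc, Nat.descFactorial_self]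
    · intro d _ hd
      rw [if_neg]
      intro h
      apply hd
      simpa [Fin.snoc, Fin.ext_iff] using h
    · simp
  | succ t =>
    rw [PiMat, Matrix.of_apply]
    simp only [forall_le_avail_iff]
    by_cases h1 : ∀ i : Fin t, β.1 i.succ ≤ α.1 i.castSucc
    · simp only [h1, implies_true, true_and, if_true]
      -- Equality of the totals of `α` and `β` already forces this condition; a full step must then
      -- exhaust the departing column, so d = l_t is the only surviving term.
      have h2 : (β.1 0 : ℕ) = (α.1 (Fin.last t) : ℕ) + ∑ i, usedOld α.1 β.1 i := by
        have hα := α.2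
        have hβ := β.2
        rw [Fin.sum_univ_succ] at hβ
        rw [Fin.sum_univ_castSucc] at hα
        have h3 : ∑ i, usedOld α.1 β.1 i + ∑ i : Fin t, (β.1 i.succ : ℕ) =
            ∑ i : Fin t, (α.1 i.castSucc : ℕ) := by
          rw [← Finset.sum_add_distrib]
          exact Finset.sum_congr rfl fun i _ => Nat.sub_add_cancel (h1 i)
        omega
      have hle := Nat.le_of_lt_succ (β.1 0).2
      have hv : (α.1 (Fin.last t) : ℕ) + usedAll α.1 β.1 = k := by
        rw [usedAll]
        omega
      rw [if_pos h2, Finset.sum_eq_single (α.1 (Fin.last t)), if_pos]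
      · rw [stepWeight_snoc_taken, hv, ← h2]
        have h4 : usedAll α.1 β.1 - ∑ i, usedOld α.1 β.1 i = k - β.1 0 := by
          rw [usedAll]
          omega
        have h5 : k - (α.1 (Fin.last t) : ℕ) - ∑ i, usedOld α.1 β.1 i = k - β.1 0 := by omega
        rw [h4, h5, Nat.choose_symm hle, Nat.choose_self, Nat.choose_self]
        push_cast
        ring
      · rw [sum_snoc_taken, hv]
      · intro d _ hd
        rw [if_neg]
        rw [sum_snoc_taken]
        intro h
        apply hd
        rw [Fin.ext_iff]
        omega
      · simp
    · simp [h1]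

end Step

/-! ### The coefficient of x^k in K and its block triangular form. -/

section TopCoefficient

variable {R : Type*} [CommRing R] {k t : ℕ} (a : Fin (t + 1) → R)

theorem stepWeight_C_mul_X (α : G k t) (q : Fin (t + 1) → Fin (k + 1)) :
    stepWeight (fun i => C (a i) * X) α q = C (stepWeight a α q) * X ^ ∑ i, (q i : ℕ) := by
  simp only [stepWeight, mul_pow, Finset.prod_mul_distrib, Finset.prod_pow_eq_pow_sum, map_mul,
    map_prod, map_pow, map_natCast, mul_assoc]

theorem natDegree_KMat_le (α β : G k t) :
    (KMat k t (fun i => C (a i) * X) α β).natDegree ≤ k := by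
  rw [KMat_apply]
  refine natDegree_sum_le_of_forall_le _ _ fun q _ => ?_
  split_ifs
  · by_cases hq : k < ∑ i, (q i : ℕ)
    · rw [stepWeight_eq_zero_of_lt_sum _ _ hq]
      simp
    · rw [stepWeight_C_mul_X]
      exact (natDegree_C_mul_X_pow_le _ _).trans (not_lt.1 hq)
  · simp

theorem coeff_KMat (α β : G k t) :
    (KMat k t (fun i => C (a i) * X) α β).coeff k = ∑ q, if step α q = β then
      if ∑ i, (q i : ℕ) = k then stepWeight a α q else 0 else 0 := by
  rw [KMat_apply, finsetSum_coeff]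
  refine Finset.sum_congr rfl fun q _ => ?_
  split_ifs with h1 h2
  · rw [stepWeight_C_mul_X, h2, coeff_C_mul_X_pow, if_pos rfl]
  · rw [stepWeight_C_mul_X, coeff_C_mul_X_pow, if_neg (Ne.symm h2)]
  · simp

theorem coeff_KMat_eq_zero {α β : G k t} (h : ∑ i, (α i : ℕ) < ∑ i, (β i : ℕ)) :
    (KMat k t (fun i => C (a i) * X) α β).coeff k = 0 := by
  rw [coeff_KMat]
  refine Finset.sum_eq_zero fun q _ => ite_eq_right_iff.2 fun h1 => ite_eq_right_iff.2 fun h2 => ?_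
  by_cases hq : ∀ i, (q i : ℕ) ≤ avail α i
  · have := sum_le_of_step_eq h1 hq h2
    omega
  · push Not at hq
    obtain ⟨i, hi⟩ := hq
    exact stepWeight_eq_zero a α i hi

theorem natDegree_pow_KMat_le (n : ℕ) (α β : G k t) :
    ((KMat k t (fun i => C (a i) * X) ^ n) α β).natDegree ≤ n * k := by
  induction n generalizing α with
  | zero =>
    rw [pow_zero, Matrix.one_apply]
    split_ifs <;> simp
  | succ n ih =>
    rw [pow_succ', Matrix.mul_apply, Nat.succ_mul, Nat.add_comm (n * k) k]
    exact natDegree_sum_le_of_forall_le _ _ fun γ _ =>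
      natDegree_mul_le_of_le (natDegree_KMat_le a α γ) (ih γ)

theorem coeff_pow_succ_KMat (n : ℕ) (α β : G k t) :
    ((KMat k t (fun i => C (a i) * X) ^ (n + 1)) α β).coeff ((n + 1) * k) =
      ∑ γ, (KMat k t (fun i => C (a i) * X) α γ).coeff k *
        ((KMat k t (fun i => C (a i) * X) ^ n) γ β).coeff (n * k) := by
  rw [pow_succ', Matrix.mul_apply, finsetSum_coeff, Nat.succ_mul, Nat.add_comm (n * k) k]
  exact Finset.sum_congr rfl fun γ _ =>
    coeff_mul_add_eq_of_natDegree_le (natDegree_KMat_le a α γ) (natDegree_pow_KMat_le a n γ β)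

theorem coeff_pow_KMat_eq_zero (n : ℕ) {α β : G k t} (h : ∑ i, (α i : ℕ) < ∑ i, (β i : ℕ)) :
    ((KMat k t (fun i => C (a i) * X) ^ n) α β).coeff (n * k) = 0 := by
  induction n generalizing α with
  | zero =>
    have : α ≠ β := by
      rintro rfl
      exact lt_irrefl _ h
    rw [pow_zero, Matrix.one_apply_ne this, coeff_zero]
  | succ n ih =>
    rw [coeff_pow_succ_KMat]
    refine Finset.sum_eq_zero fun γ _ => ?_
    rcases le_or_gt (∑ i, (γ i : ℕ)) (∑ i, (α i : ℕ)) with hγ | hγ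
    · rw [ih (hγ.trans_lt h), mul_zero]
    · rw [coeff_KMat_eq_zero a hγ, zero_mul]

/-- The powers of `PiMat` consist of the top coefficients of the powers of `KMat`. -/
theorem coeff_pow_KMat (n : ℕ) {r : ℕ} (α β : GSum k r t) :
    ((KMat k t (fun i => C (a i) * X) ^ n) α.1 β.1).coeff (n * k) = (PiMat k r t a ^ n) α β := by
  induction n generalizing α with
  | zero =>
    rw [pow_zero, pow_zero, Matrix.one_apply, Matrix.one_apply]
    simp only [Subtype.ext_iff]
    split_ifs <;> simp
  | succ n ih =>
    rw [coeff_pow_succ_KMat, pow_succ', Matrix.mul_apply,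
      ← Finset.sum_subset (Finset.subset_univ (Finset.univ.filter fun γ : G k t =>
        ∑ i, (γ i : ℕ) = r)),
      Finset.sum_subtype (p := fun γ : G k t => ∑ i, (γ i : ℕ) = r) _ (by simp)]
    · refine Finset.sum_congr rfl fun γ _ => ?_
      rw [ih, coeff_KMat, PiMat_apply]
    · intro γ _ hγ
      simp only [Finset.mem_filter, Finset.mem_univ, true_and] at hγ
      -- The total never increases along steps of top degree, so an intermediate state with another
      -- total contributes nothing between states of equal total.
      rcases lt_or_gt_of_ne hγ with h | h
      · rw [coeff_pow_KMat_eq_zero a n (h.trans_eq β.2.symm), mul_zero]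
      · rw [coeff_KMat_eq_zero a (α.2.trans_lt h), zero_mul]

end TopCoefficient

/-! ### Powers of the transfer matrix -/

theorem pow_apply_eq_sum_walks {S ι : Type*} [CommRing S] [Fintype ι] [DecidableEq ι]
    (M : Matrix ι ι S) (n : ℕ) (α β : ι) :
    (M ^ n) α β = ∑ w : Fin (n + 1) → ι, if w 0 = α ∧ w (Fin.last n) = β then
      ∏ s : Fin n, M (w s.castSucc) (w s.succ) else 0 := by
  induction n generalizing α with
  | zero =>
    rw [← (Equiv.funUnique (Fin 1) ι).symm.sum_comp]
    simp [Matrix.one_apply, ite_and]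
  | succ n ih =>
    symm
    rw [← (Fin.consEquiv fun _ => ι).sum_comp, Fintype.sum_prod_type, pow_succ', Matrix.mul_apply,
      Finset.sum_eq_single α]
    · simp only [ih, Finset.mul_sum]
      symm
      rw [Finset.sum_comm]
      refine Finset.sum_congr rfl fun w _ => ?_
      rw [Finset.sum_eq_single (w 0)]
      · simp only [Fin.consEquiv, Equiv.coe_fn_mk, Fin.cons_zero, true_and, ← Fin.succ_last,
          Fin.cons_succ, Fin.prod_univ_succ (n := n), Fin.castSucc_zero, mul_ite, mul_zero,
          ← Fin.succ_castSucc]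
      · intro γ _ hγ
        rw [if_neg fun h => hγ h.1.symm, mul_zero]
      · simp
    · intro x _ hx
      refine Finset.sum_eq_zero fun w _ => if_neg fun h => hx ?_
      simpa [Fin.consEquiv] using h.1
    · simp

theorem sum_pow_apply_eq_sum_walks {S ι : Type*} [CommRing S] [Fintype ι] [DecidableEq ι]
    (M : Matrix ι ι S) (n : ℕ) (Q : ι → ι → Prop) [∀ α β, Decidable (Q α β)] :
    ∑ α, ∑ β, (if Q α β then (M ^ n) α β else 0) =
      ∑ w : Fin (n + 1) → ι, if Q (w 0) (w (Fin.last n)) then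
        ∏ s : Fin n, M (w s.castSucc) (w s.succ) else 0 := by
  have h1 : ∀ α β, (if Q α β then (M ^ n) α β else 0) =
      ∑ w : Fin (n + 1) → ι, if w 0 = α then if w (Fin.last n) = β then
        if Q (w 0) (w (Fin.last n)) then ∏ s : Fin n, M (w s.castSucc) (w s.succ) else 0 else 0
        else 0 := by
    intro α β
    split_ifs with hQ
    · rw [pow_apply_eq_sum_walks]
      refine Finset.sum_congr rfl fun w _ => ?_
      rw [ite_and]
      split_ifs with h1 h2 h3
      · rfl
      · exact absurd (h1 ▸ h2 ▸ hQ) h3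
      · rfl
      · rfl
    · refine (Finset.sum_eq_zero fun w _ => ?_).symm
      split_ifs with h1 h2 h3
      · exact absurd (h1 ▸ h2 ▸ h3) hQ
      all_goals rfl
  simp only [h1]
  rw [Finset.sum_congr rfl fun α _ => Finset.sum_comm, Finset.sum_comm]
  simp

/-! ### Walks determined by the numbers of places taken. -/

section Walk

variable {S : Type*} [CommRing S] {k t n : ℕ}

/-- The walk `w` takes the steps `q`. -/
def Follows (q : Fin n × Fin (t + 1) → Fin (k + 1)) (w : Fin (n + 1) → G k t) : Prop :=
  ∀ s : Fin n, step (w s.castSucc) (fun i => q (s, i)) = w s.succ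

theorem Follows.eq_of_zero {q : Fin n × Fin (t + 1) → Fin (k + 1)} {w w' : Fin (n + 1) → G k t}
    (h : Follows q w) (h' : Follows q w') (h0 : w 0 = w' 0) : w = w' := by
  funext s
  induction s using Fin.induction with
  | zero => exact h0
  | succ s ih => rw [← h s, ← h' s, ih]

/-- Induction on the age of a column in the window: a new column always has k free places, and the
count at age i+1 is computed from age i one step earlier. Closedness supplies the step before time
0, so no initial state is needed. -/
theorem Follows.eq_of_closed {q : Fin n × Fin (t + 1) → Fin (k + 1)} {w w' : Fin (n + 1) → G k t}
    (h : Follows q w) (h' : Follows q w') (hn : n ≠ 0) (h0 : w 0 = w (Fin.last n))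
    (h0' : w' 0 = w' (Fin.last n)) : w = w' := by
  obtain ⟨n, rfl⟩ := Nat.exists_eq_succ_of_ne_zero hn
  have key : ∀ (i : Fin (t + 1)) (s : Fin (n + 1 + 1)), avail (w s) i = avail (w' s) i := by
    intro i
    induction i using Fin.induction with
    | zero => exact fun s => rfl
    | succ i ih =>
      have hs : ∀ s : Fin (n + 1), avail (w s.succ) i.succ = avail (w' s.succ) i.succ := by
        intro s
        rw [← h s, ← h' s, avail_succ, avail_succ, step, step]
        simp only [ih]
      intro s
      refine Fin.cases ?_ hs s
      rw [h0, h0', ← Fin.succ_last]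
      exact hs _
  funext s i
  exact Fin.ext (key i.succ s)

/-- The boundary condition `Q` (closed, or with prescribed ends) leaves at most one walk for each
choice of `q`, so the sum over walks and steps collapses to a sum over `q`. -/
theorem sum_pow_KMat_eq_sum_follows (a : Fin (t + 1) → S) (n : ℕ) (Q : G k t → G k t → Prop)
    [∀ α β, Decidable (Q α β)] (st : (Fin n × Fin (t + 1) → Fin (k + 1)) → Fin (n + 1) → G k t)
    (hst : ∀ q, Follows q (st q))
    (huniq : ∀ q w, Follows q w → Q (w 0) (w (Fin.last n)) → w = st q) :
    ∑ α, ∑ β, (if Q α β then (KMat k t a ^ n) α β else 0) =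
      ∑ q : Fin n × Fin (t + 1) → Fin (k + 1), if Q (st q 0) (st q (Fin.last n)) then
        ∏ s : Fin n, stepWeight a (st q s.castSucc) (fun i => q (s, i)) else 0 := by
  classical
  rw [sum_pow_apply_eq_sum_walks]
  have h1 : ∀ w : Fin (n + 1) → G k t, (if Q (w 0) (w (Fin.last n)) then
      ∏ s : Fin n, KMat k t a (w s.castSucc) (w s.succ) else 0) =
      ∑ q : Fin n × Fin (t + 1) → Fin (k + 1), if Q (w 0) (w (Fin.last n)) ∧ Follows q w then
        ∏ s : Fin n, stepWeight a (w s.castSucc) (fun i => q (s, i)) else 0 := by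
    intro w
    split_ifs with hQ
    · simp only [KMat_apply]
      rw [Finset.prod_univ_sum, Fintype.piFinset_univ,
        ← (Equiv.curry (Fin n) (Fin (t + 1)) (Fin (k + 1))).sum_comp]
      refine Finset.sum_congr rfl fun q _ => ?_
      simp only [true_and, hQ, Equiv.curry_apply]
      split_ifs with hF
      · exact Finset.prod_congr rfl fun s _ => if_pos (hF s)
      · simp only [Follows, not_forall] at hF
        obtain ⟨s, hs⟩ := hF
        exact Finset.prod_eq_zero (Finset.mem_univ s) (if_neg hs)
    · simp [hQ]
  simp only [h1]
  rw [Finset.sum_comm]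
  refine Finset.sum_congr rfl fun q _ => ?_
  rw [Finset.sum_eq_single (st q)]
  · simp only [hst q, and_true]
  · intro w _ hw
    exact if_neg fun h => hw (huniq q w h.2 h.1)
  · simp

end Walk

/-! ### Toeplitz edges -/

section Edges

variable {J : Type*} [AddCommGroup J] [DecidableEq J] (φ : ℤ →+ J) {k t n : ℕ}

/-- The column of the edge in slot `i` of the row which is processed at time `s`. -/
def edgeCol (e : Fin n × Fin (t + 1)) : J := φ (((e.1 : ℕ) : ℤ) - ((e.2 : ℕ) : ℤ))

/-- The slot of an edge. -/
def edgeSlot (e : Fin n × Fin (t + 1)) : ℕ := e.2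

/-- The state at time `s`, if the edges `e` get `q e` places. -/
def stateAt (d : J → ℕ) (hd : ∀ c, d c ≤ k) (q : Fin n × Fin (t + 1) → Fin (k + 1)) (s : ℕ) :
    G k t := fun i =>
  ⟨d (φ ((s : ℤ) - (i + 1))) - ∑ e ∈ edgesBefore (edgeCol φ) edgeSlot (φ ((s : ℤ) - (i + 1))) (i + 1),
    (q e : ℕ), Nat.lt_succ_of_le ((Nat.sub_le _ _).trans (hd _))⟩

variable {φ}

-- Column and slot determine the row, even modulo n where one row and one column can be joined by
-- several edges.
omit [DecidableEq J] in
theorem edge_eq (hφ : ∀ s s' : Fin n, φ (s : ℕ) = φ (s' : ℕ) → s = s')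
    (e e' : Fin n × Fin (t + 1)) (hc : edgeCol φ e = edgeCol φ e') (hs : edgeSlot e = edgeSlot e') :
    e = e' := by
  have h2 : e.2 = e'.2 := Fin.ext hs
  rw [edgeCol, edgeCol, h2, map_sub, map_sub, sub_left_inj] at hc
  exact Prod.ext (hφ _ _ hc) h2

variable {d : J → ℕ} {hd : ∀ c, d c ≤ k} (hk : ∀ s : Fin n, d (φ (s : ℕ)) = k)
  (q : Fin n × Fin (t + 1) → Fin (k + 1))

include hk in
theorem avail_stateAt (s : Fin n) (i : Fin (t + 1)) :
    avail (stateAt φ d hd q s) i = d (edgeCol φ (s, i)) -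
      ∑ e ∈ edgesBefore (edgeCol φ) edgeSlot (edgeCol φ (s, i)) i, (q e : ℕ) := by
  refine Fin.cases ?_ (fun j => ?_) i
  · simp [edgesBefore, edgeCol, hk]
  · simp [stateAt, edgeCol]

-- Moving from time s to s+1 makes every kept column one slot older and adds exactly the edge of row
-- s to those already served in it.
include hk in
theorem step_stateAt (hφ : ∀ s s' : Fin n, φ (s : ℕ) = φ (s' : ℕ) → s = s') (s : Fin n) :
    step (stateAt φ d hd q s) (fun i => q (s, i)) = stateAt φ d hd q (s + 1 : ℕ) := by
  funext i
  have h1 : φ (((s + 1 : ℕ) : ℤ) - ((i : ℕ) + 1)) = edgeCol φ (s, i.castSucc) := by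
    simp [edgeCol]
  have h2 := edgesBefore_succ (edge_eq (t := t) hφ) (s, i.castSucc)
  have h3 := notMem_edgesBefore (col := edgeCol φ) (slot := edgeSlot) (s, i.castSucc)
  have h4 : edgeSlot (s, i.castSucc) = i := rfl
  rw [h4] at h2 h3
  rw [Fin.ext_iff, step, stateAt]
  simp only [avail_stateAt hk, h1, h2, Fin.val_castSucc]
  rw [Finset.sum_insert h3, Nat.sub_sub]
  exact congrArg _ (Nat.add_comm _ _)

include hk in
theorem prod_stepWeight_stateAt {S : Type*} [CommRing S] (a : Fin (t + 1) → S) :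
    ∏ s : Fin n, stepWeight a (stateAt φ d hd q s) (fun i => q (s, i)) =
      (((∏ s : Fin n, k.descFactorial (∑ i, (q (s, i) : ℕ))) *
        colMult (edgeCol φ) edgeSlot d (fun e => q e) : ℕ) : S) * ∏ e, a e.2 ^ (q e : ℕ) := by
  simp only [stepWeight]
  rw [Finset.prod_mul_distrib, ← Nat.cast_prod, Finset.prod_mul_distrib, Fintype.prod_prod_type,
    colMult, Fintype.prod_prod_type]
  simp only [avail_stateAt hk]
  rfl

-- The binomials of a step are the factors of `colMult` for the edges of its row, so multiplying
-- over the rows recovers the placement count with column capacities `d`.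
include hk in
omit q in
theorem sum_pow_KMat_eq_sum_edges {S : Type*} [CommRing S] (a : Fin (t + 1) → S)
    (hφ : ∀ s s' : Fin n, φ (s : ℕ) = φ (s' : ℕ) → s = s') (Q : G k t → G k t → Prop)
    [∀ α β, Decidable (Q α β)]
    (huniq : ∀ (q : Fin n × Fin (t + 1) → Fin (k + 1)) w, Follows q w →
      Q (w 0) (w (Fin.last n)) → w = fun s : Fin (n + 1) => stateAt φ d hd q s) :
    ∑ α, ∑ β, (if Q α β then (KMat k t a ^ n) α β else 0) =
      ∑ q : Fin n × Fin (t + 1) → Fin (k + 1),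
        if Q (stateAt φ d hd q 0) (stateAt φ d hd q n) then
          (((∏ s : Fin n, k.descFactorial (∑ i, (q (s, i) : ℕ))) *
            colMult (edgeCol φ) edgeSlot d (fun e => q e) : ℕ) : S) * ∏ e, a e.2 ^ (q e : ℕ)
        else 0 := by
  rw [sum_pow_KMat_eq_sum_follows a n Q (fun q s => stateAt φ d hd q s)
    (fun q s => step_stateAt hk q hφ s) huniq]
  refine Finset.sum_congr rfl fun q _ => ?_
  rw [← prod_stepWeight_stateAt hk q a]
  rfl

end Edges

/-! ### Rook polynomials of banded block matrices. -/

section Rook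

variable {R J : Type*} [CommRing R] [AddCommGroup J] [DecidableEq J] {φ : ℤ →+ J} {k t n : ℕ}

theorem placementSum_eq_sum_fin {S E I J : Type*} [CommRing S] [Fintype E] [DecidableEq E]
    [Fintype I] [DecidableEq I] [DecidableEq J] (row : E → I) (col : E → J) (slot : E → ℕ)
    (w : E → S) {k B : ℕ} (hB : k ≤ B) (d : J → ℕ) :
    placementSum row col slot w B (fun _ => k) d = ∑ q : E → Fin (k + 1),
      (placements row col slot (fun _ => k) d (fun e => q e) : S) * ∏ e, w e ^ (q e : ℕ) := by
  rw [placementSum]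
  symm
  refine Finset.sum_of_injOn (fun q e => (q e : ℕ)) ?_ ?_ ?_ fun _ _ => rfl
  · intro q _ q' _ h
    funext e
    exact Fin.ext (congrFun h e)
  · intro q _
    simp only [Finset.mem_coe, Fintype.mem_piFinset, Finset.mem_range]
    exact fun e => (q e).2.trans_le (by omega)
  · intro p _ hp
    have : ∃ e, k < p e := by
      by_contra! h
      exact hp ⟨fun e => ⟨p e, Nat.lt_succ_of_le (h e)⟩, by simp, rfl⟩
    obtain ⟨e, he⟩ := this
    rw [placements_eq_zero e he, Nat.cast_zero, zero_mul]

/-- The rook polynomial of a banded matrix with blocks of size `k`. -/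
theorem rookPoly_kronecker (hφ : ∀ s s' : Fin n, φ (s : ℕ) = φ (s' : ℕ) → s = s') (r : ℕ)
    (a : Fin (t + 1) → R) (A : Matrix (Fin n) (Fin n) R)
    (hA : ∀ i j : Fin n, A i j = ∑ m : Fin (t + 1),
      if φ (((j : ℕ) : ℤ) - (i : ℕ)) = φ (-(r : ℤ) + (m : ℕ)) then a m else 0) :
    rookPoly (A ⊗ₖ JMat R k) = ∑ q : Fin n × Fin (t + 1) → Fin (k + 1),
      (((∏ s : Fin n, k.descFactorial (∑ i, (q (s, i) : ℕ))) *
        colMult (edgeCol φ) edgeSlot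
          (fun c => if ∃ j : Fin n, φ ((n : ℤ) - 1 - r - (j : ℕ)) = c then k else 0)
          (fun e => q e) : ℕ) : R[X]) * ∏ e, (C (a e.2) * X) ^ (q e : ℕ) := by
  classical
  -- Row i is processed at time s = n−1−i and column j carries the label n−1−r−j, so j − i = −r + m
  -- becomes s − m = n−1−r−j: the slot m carries the weight `a m`.
  have hentry : ∀ x y : Fin n × Fin k, (A ⊗ₖ JMat R k) x y =
      ∑ e : Fin n × Fin (t + 1) with e.1.rev = x.1 ∧
        edgeCol φ e = φ ((n : ℤ) - 1 - r - (y.1 : ℕ)), a e.2 := by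
    rintro ⟨i, s⟩ ⟨j, s'⟩
    rw [Matrix.kroneckerMap_apply, JMat, Matrix.of_apply, mul_one, hA, Finset.sum_filter,
      Fintype.sum_prod_type, Finset.sum_eq_single i.rev]
    · refine Finset.sum_congr rfl fun m _ => ?_
      simp only [Fin.rev_rev, true_and, edgeCol, Fin.val_rev]
      have hi := i.2
      rw [Nat.cast_sub (by omega)]
      refine if_congr ?_ rfl rfl
      rw [← sub_eq_zero, ← map_sub, ← sub_eq_zero (a := φ (_ - (m : ℕ))), ← map_sub]
      refine iff_of_eq ?_
      congr 2
      push_cast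
      ring
    · intro s _ hs
      refine Finset.sum_eq_zero fun m _ => if_neg fun h => hs ?_
      exact (Fin.rev_rev s).symm.trans (congrArg Fin.rev h.1)
    · simp
  have hκ : ∀ j j' : Fin n, φ ((n : ℤ) - 1 - r - (j : ℕ)) = φ ((n : ℤ) - 1 - r - (j' : ℕ)) →
      j = j' := by
    intro j j' h
    rw [map_sub, map_sub φ _ ((j' : ℕ) : ℤ), sub_right_inj] at h
    exact hφ _ _ h
  have hrow : (fun i => (Finset.univ.filter fun x : Fin n × Fin k => x.1 = i).card) =
      fun _ => k := by
    funext i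
    have : (Finset.univ.filter fun x : Fin n × Fin k => x.1 = i) = {i} ×ˢ Finset.univ := by
      ext ⟨x, y⟩
      simp [eq_comm]
    rw [this, Finset.card_product]
    simp
  have hcol : (fun c => (Finset.univ.filter fun y : Fin n × Fin k =>
      φ ((n : ℤ) - 1 - r - (y.1 : ℕ)) = c).card) =
      fun c => if ∃ j : Fin n, φ ((n : ℤ) - 1 - r - (j : ℕ)) = c then k else 0 := by
    funext c
    split_ifs with h
    · obtain ⟨j, rfl⟩ := h
      have : (Finset.univ.filter fun y : Fin n × Fin k =>
          φ ((n : ℤ) - 1 - r - (y.1 : ℕ)) = φ ((n : ℤ) - 1 - r - (j : ℕ))) =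
          {j} ×ˢ Finset.univ := by
        ext ⟨x, y⟩
        simp only [Finset.mem_filter, Finset.mem_univ, true_and, Finset.mem_product,
          Finset.mem_singleton, and_true]
        exact ⟨hκ x j, fun h => by rw [h]⟩
      rw [this, Finset.card_product]
      simp
    · rw [Finset.card_eq_zero, Finset.filter_eq_empty_iff]
      exact fun y _ hy => h ⟨y.1, hy⟩
  rw [rookPoly_eq_rookSum]
  simp only [hentry]
  -- The bound `card + k` serves both the induction over rows, which needs the number of rows, and
  -- the passage to `Fin (k + 1)`, which needs k.
  rw [rookSum_eq_placementSum (fun e : Fin n × Fin (t + 1) => e.1.rev) (edge_eq hφ)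
    (fun e => a e.2) (fun y : Fin n × Fin k => φ ((n : ℤ) - 1 - r - (y.1 : ℕ)))
    (Fintype.card (Fin n × Fin k) + k) _ Prod.fst (Nat.le_add_right _ _), hrow, hcol,
    placementSum_eq_sum_fin _ _ _ _ (Nat.le_add_left _ _)]
  refine Finset.sum_congr rfl fun q _ => ?_
  congr 3
  rw [placements, ← Equiv.prod_comp Fin.revPerm]
  congr 1
  refine Finset.prod_congr rfl fun s _ => ?_
  congr 1
  rw [Finset.sum_filter, Fintype.sum_prod_type, Finset.sum_eq_single s]
  · simp
  · intro s' _ hs'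
    simp [hs']
  · simp

/-- The rook polynomial of a banded matrix on a cycle. -/
theorem rookPoly_kronecker_of_periodic (hφ : ∀ s s' : Fin n, φ (s : ℕ) = φ (s' : ℕ) → s = s')
    (hper : φ (n : ℤ) = 0) (hn : n ≠ 0) (r : ℕ)
    (hex : ∀ c, ∃ j : Fin n, φ ((n : ℤ) - 1 - r - (j : ℕ)) = c)
    (a : Fin (t + 1) → R) (A : Matrix (Fin n) (Fin n) R)
    (hA : ∀ i j : Fin n, A i j = ∑ m : Fin (t + 1),
      if φ (((j : ℕ) : ℤ) - (i : ℕ)) = φ (-(r : ℤ) + (m : ℕ)) then a m else 0) :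
    rookPoly (A ⊗ₖ JMat R k) = ((KMat k t fun i => C (a i) * X) ^ n).trace := by
  have hclosed : ∀ q : Fin n × Fin (t + 1) → Fin (k + 1),
      stateAt φ (fun _ => k) (fun _ => le_rfl) q 0 =
        stateAt φ (fun _ => k) (fun _ => le_rfl) q n := by
    intro q
    have : ∀ i : Fin t, φ (((0 : ℕ) : ℤ) - (i + 1)) = φ ((n : ℤ) - (i + 1)) := by
      intro i
      rw [map_sub, map_sub φ (n : ℤ), hper, Nat.cast_zero, map_zero]
    funext i
    simp only [stateAt, this]
  have htr : ((KMat k t fun i => C (a i) * X) ^ n).trace = ∑ α, ∑ β, if α = β then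
      ((KMat k t fun i => C (a i) * X) ^ n) α β else 0 := by
    simp [Matrix.trace]
  have hk : ∀ s : Fin n, (fun _ : J => k) (φ (s : ℕ)) = k := fun _ => rfl
  have hd : ∀ c : J, (fun _ : J => k) c ≤ k := fun _ => le_rfl
  rw [rookPoly_kronecker hφ r a A hA, htr, sum_pow_KMat_eq_sum_edges (hd := hd) hk _ hφ]
  · refine Finset.sum_congr rfl fun q _ => ?_
    rw [if_pos (hclosed q)]
    simp only [hex, if_true]
  · intro q w hw h0
    exact hw.eq_of_closed (w' := fun s : Fin (n + 1) => stateAt φ (fun _ => k) hd q s)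
      (fun s => step_stateAt hk q hφ s) hn h0 (hclosed q)

end Rook

/-! ### Rook polynomials of circulants -/

section Circulant

variable {R : Type*} [CommRing R] {k t n : ℕ}

theorem intCast_fin_injective (s s' : Fin n)
    (h : Int.castAddHom (ZMod n) (s : ℕ) = Int.castAddHom (ZMod n) (s' : ℕ)) : s = s' := by
  have h1 : ((s : ℕ) : ZMod n) = ((s' : ℕ) : ZMod n) := by simpa using h
  rw [ZMod.natCast_eq_natCast_iff'] at h1
  rwa [Nat.mod_eq_of_lt s.2, Nat.mod_eq_of_lt s'.2, ← Fin.ext_iff] at h1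

theorem exists_intCast_fin_eq [NeZero n] (c : ZMod n) :
    ∃ s : Fin n, Int.castAddHom (ZMod n) (s : ℕ) = c :=
  ⟨⟨c.val, c.val_lt⟩, by simp⟩

/-- The `n × n` matrix with entry `1` where `j - i ≡ z (mod n)`. -/
def shiftMat (R : Type*) [CommRing R] (n : ℕ) (z : ℤ) : Matrix (Fin n) (Fin n) R :=
  Matrix.of fun i j => if Int.castAddHom (ZMod n) (((j : ℕ) : ℤ) - (i : ℕ)) =
    Int.castAddHom (ZMod n) z then 1 else 0

theorem shiftMat_zero : shiftMat R n 0 = 1 := by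
  ext i j
  rw [shiftMat, Matrix.of_apply, Matrix.one_apply]
  refine if_congr ?_ rfl rfl
  rw [map_sub, map_zero, sub_eq_zero]
  exact ⟨fun h => (intCast_fin_injective _ _ h).symm, fun h => by rw [h]⟩

theorem shiftMat_mul [NeZero n] (z z' : ℤ) :
    shiftMat R n z * shiftMat R n z' = shiftMat R n (z + z') := by
  ext i j
  obtain ⟨l, hl⟩ := exists_intCast_fin_eq (n := n) (Int.castAddHom (ZMod n) ((i : ℕ) + z))
  rw [Matrix.mul_apply, Finset.sum_eq_single l]
  · simp only [shiftMat, Matrix.of_apply, map_sub, map_add, hl]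
    rw [if_pos (by ring), one_mul]
    refine if_congr ?_ rfl rfl
    constructor <;> intro h <;> linear_combination h
  · intro l' _ hl'
    rw [shiftMat, Matrix.of_apply, if_neg, zero_mul]
    intro h
    apply hl'
    apply intCast_fin_injective
    rw [hl, map_add, ← h, map_sub]
    ring
  · simp

theorem PMat_eq_shiftMat : PMat R n = shiftMat R n 1 := by
  ext i j
  rw [PMat, shiftMat, Matrix.of_apply, Matrix.of_apply]
  refine if_congr ?_ rfl rfl
  simp only [Int.coe_castAddHom]
  exact (ZMod.intCast_eq_intCast_iff _ _ _).symm

theorem PMat_pow [NeZero n] (m : ℕ) : PMat R n ^ m = shiftMat R n m := by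
  induction m with
  | zero => rw [pow_zero, Nat.cast_zero, shiftMat_zero]
  | succ m ih => rw [pow_succ, ih, PMat_eq_shiftMat, shiftMat_mul, Nat.cast_succ]

theorem PMat_zpow [NeZero n] (z : ℤ) : PMat R n ^ z = shiftMat R n z := by
  cases z with
  | ofNat m => exact (zpow_natCast _ _).trans (PMat_pow m)
  | negSucc m =>
    rw [zpow_negSucc, PMat_pow]
    refine Matrix.inv_eq_right_inv ?_
    rw [shiftMat_mul, Int.negSucc_eq, ← shiftMat_zero]
    congr 1
    push_cast
    ring

theorem circulant_apply [NeZero n] (r : ℕ) (a : Fin (t + 1) → R) (i j : Fin n) :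
    circulant r a n i j = ∑ m : Fin (t + 1),
      if Int.castAddHom (ZMod n) (((j : ℕ) : ℤ) - (i : ℕ)) =
        Int.castAddHom (ZMod n) (-(r : ℤ) + (m : ℕ)) then a m else 0 := by
  rw [circulant, Matrix.sum_apply]
  refine Finset.sum_congr rfl fun m _ => ?_
  rw [Matrix.smul_apply, PMat_zpow, shiftMat, Matrix.of_apply]
  simp

theorem rookPoly_circulant (hn : n ≠ 0) (r : ℕ) (a : Fin (t + 1) → R) :
    rookPoly (circulant r a n ⊗ₖ JMat R k) = ((KMat k t fun i => C (a i) * X) ^ n).trace := by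
  have : NeZero n := ⟨hn⟩
  have hex : ∀ c : ZMod n, ∃ j : Fin n,
      Int.castAddHom (ZMod n) ((n : ℤ) - 1 - r - (j : ℕ)) = c := by
    intro c
    obtain ⟨j, hj⟩ := exists_intCast_fin_eq (Int.castAddHom (ZMod n) ((n : ℤ) - 1 - r) - c)
    exact ⟨j, by rw [map_sub, hj, sub_sub_cancel]⟩
  exact rookPoly_kronecker_of_periodic intCast_fin_injective (by simp) hn r hex a _
    (circulant_apply r a)

end Circulant

/-! ### Rook polynomials of Toeplitz matrices -/

section Toeplitz

variable {R : Type*} [CommRing R] {k t n : ℕ}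

theorem toeplitz_apply (r : ℕ) (a : Fin (t + 1) → R) (i j : Fin n) :
    toeplitz r a n i j = ∑ m : Fin (t + 1),
      if AddMonoidHom.id ℤ (((j : ℕ) : ℤ) - (i : ℕ)) = AddMonoidHom.id ℤ (-(r : ℤ) + (m : ℕ))
        then a m else 0 := by
  rw [toeplitz, Matrix.sum_apply]
  refine Finset.sum_congr rfl fun m _ => ?_
  rw [Matrix.smul_apply, TMat, Matrix.of_apply]
  simp

/-- The numbers of free places in the columns before the first step, if the columns which have
not yet entered the window are free. -/
def startCap (k r : ℕ) (c : ℤ) : ℕ := if -(r : ℤ) ≤ c then k else 0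

theorem startCap_le (k r : ℕ) (c : ℤ) : startCap k r c ≤ k := by
  rw [startCap]
  split_ifs <;> simp

theorem startCap_natCast (k r s : ℕ) : startCap k r (s : ℤ) = k :=
  if_pos (by omega)

/-- Before the first step the window holds the labels −1, …, −t. Those down to −r are untouched
columns of the matrix; the others do not exist and have capacity 0. -/
theorem stateAt_startCap_zero (k r : ℕ) (q : Fin n × Fin (t + 1) → Fin (k + 1)) :
    stateAt (AddMonoidHom.id ℤ) (startCap k r) (startCap_le k r) q 0 = full k r t := by
  funext i
  have h : edgesBefore (edgeCol (n := n) (t := t) (AddMonoidHom.id ℤ)) edgeSlot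
      (-1 + -((i : ℕ) : ℤ)) (i + 1) = ∅ := by
    rw [edgesBefore, Finset.filter_eq_empty_iff]
    rintro ⟨s, j⟩ -
    simp only [edgeCol, edgeSlot, AddMonoidHom.id_apply]
    omega
  rw [Fin.ext_iff]
  simp only [stateAt, AddMonoidHom.id_apply, Nat.cast_zero, zero_sub, neg_add_rev, h,
    Finset.sum_empty, Nat.sub_zero, full, startCap]
  by_cases hi : (i : ℕ) < r
  · rw [if_pos hi, if_pos (by omega), Fin.val_last]
  · rw [if_neg hi, if_neg (by omega), Fin.val_zero]

/-- The labels n−r, …, n−1 lie outside the matrix, although the transfer matrix lets them enter with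
k free places. As r ≤ t they are still in the final window, where containing u means that they were
never used. -/
theorem full_le_stateAt_iff {r : ℕ} (hrt : r ≤ t) (q : Fin n × Fin (t + 1) → Fin (k + 1)) :
    (∀ i, full k r t i ≤ stateAt (AddMonoidHom.id ℤ) (startCap k r) (startCap_le k r) q n i) ↔
      ∀ e : Fin n × Fin (t + 1), (n : ℤ) - r ≤ edgeCol (AddMonoidHom.id ℤ) e → (q e : ℕ) = 0 := by
  have hcap : ∀ i : Fin t, (i : ℕ) < r → startCap k r ((n : ℤ) - (i + 1)) = k := fun i hi =>
    if_pos (by omega)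
  constructor
  · rintro h ⟨s, j⟩ he
    simp only [edgeCol, AddMonoidHom.id_apply] at he
    have hs := s.2
    obtain ⟨i, hi⟩ : ∃ i : ℕ, (i : ℤ) = (n : ℤ) - 1 - (s - j) ∨ ((n : ℤ) - 1 - (s - j) < 0) :=
      ⟨((n : ℤ) - 1 - (s - j)).toNat, by omega⟩
    have hi' : (i : ℤ) = (n : ℤ) - 1 - (s - j) := by omega
    have h1 := h ⟨i, by omega⟩
    simp only [full, Fin.le_def, stateAt, AddMonoidHom.id_apply] at h1
    have hir : i < r := by omega
    rw [if_pos hir, Fin.val_last, hcap ⟨i, by omega⟩ hir] at h1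
    have hmem : ((s, j) : Fin n × Fin (t + 1)) ∈ edgesBefore (edgeCol (AddMonoidHom.id ℤ)) edgeSlot
        ((n : ℤ) - ((i : ℕ) + 1)) (i + 1) := by
      simp only [edgesBefore, Finset.mem_filter, Finset.mem_univ, true_and, edgeCol,
        AddMonoidHom.id_apply, edgeSlot]
      omega
    -- From k ≤ k − ∑ the sum is 0 when k > 0; for k = 0 the bound q ≤ k, recorded next, is what is
    -- needed.
    have h2 := Finset.single_le_sum (f := fun e => (q e : ℕ)) (fun _ _ => Nat.zero_le _) hmem
    have h3 := (q (s, j)).2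
    omega
  · intro h i
    by_cases hi : (i : ℕ) < r
    · simp only [Fin.le_def, stateAt, AddMonoidHom.id_apply]
      rw [hcap i hi, Finset.sum_eq_zero, Nat.sub_zero]
      · exact Nat.le_of_lt_succ (full k r t i).2
      · intro e he
        simp only [edgesBefore, Finset.mem_filter] at he
        refine h e ?_
        rw [he.2.1]
        omega
    · simp [full, hi]

/-- Compares the true capacities, zero from label n−r on, with those of the transfer matrix: a rook
on a nonexistent column kills the product, and otherwise the two agree on every edge in use. -/
theorem colMult_startCap {r : ℕ} (q : Fin n × Fin (t + 1) → Fin (k + 1)) :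
    colMult (edgeCol (AddMonoidHom.id ℤ)) edgeSlot
      (fun c => if ∃ j : Fin n, AddMonoidHom.id ℤ ((n : ℤ) - 1 - r - (j : ℕ)) = c then k else 0)
      (fun e => q e) =
    if ∀ e : Fin n × Fin (t + 1), (n : ℤ) - r ≤ edgeCol (AddMonoidHom.id ℤ) e → (q e : ℕ) = 0 then
      colMult (edgeCol (AddMonoidHom.id ℤ)) edgeSlot (startCap k r) (fun e => q e) else 0 := by
  split_ifs with h
  · refine Finset.prod_congr rfl fun e _ => ?_
    rcases le_or_gt ((n : ℤ) - r) (edgeCol (AddMonoidHom.id ℤ) e) with he | he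
    · simp only [h e he]
      rw [Nat.choose_zero_right, Nat.choose_zero_right]
    · congr 2
      rw [startCap]
      refine if_congr ⟨?_, fun h1 => ?_⟩ rfl rfl
      · rintro ⟨j, hj⟩
        rw [← hj, AddMonoidHom.id_apply]
        have := j.2
        omega
      · refine ⟨⟨((n : ℤ) - 1 - r - edgeCol (AddMonoidHom.id ℤ) e).toNat, by omega⟩, ?_⟩
        simp only [AddMonoidHom.id_apply]
        omega
  · push Not at h
    obtain ⟨e, he, hq⟩ := h
    refine Finset.prod_eq_zero (Finset.mem_univ e) ?_
    simp only
    rw [if_neg, Nat.zero_sub, Nat.choose_eq_zero_of_lt (Nat.pos_of_ne_zero hq)]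
    rintro ⟨j, hj⟩
    rw [← hj, AddMonoidHom.id_apply] at he
    omega

theorem rookPoly_toeplitz {r : ℕ} (hrt : r ≤ t) (a : Fin (t + 1) → R) (n : ℕ) :
    rookPoly (toeplitz r a n ⊗ₖ JMat R k) =
      ∑ γ : G k t with ∀ i, full k r t i ≤ γ i,
        ((KMat k t fun i => C (a i) * X) ^ n) (full k r t) γ := by
  have hφ : ∀ s s' : Fin n, AddMonoidHom.id ℤ (s : ℕ) = AddMonoidHom.id ℤ (s' : ℕ) → s = s' := by
    intro s s' h
    simpa [Fin.ext_iff] using h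
  have hk : ∀ s : Fin n, startCap k r (AddMonoidHom.id ℤ (s : ℕ)) = k :=
    fun s => startCap_natCast k r s
  have hsum : ∑ γ : G k t with ∀ i, full k r t i ≤ γ i,
      ((KMat k t fun i => C (a i) * X) ^ n) (full k r t) γ =
      ∑ α, ∑ β, if α = full k r t ∧ ∀ i, full k r t i ≤ β i then
        ((KMat k t fun i => C (a i) * X) ^ n) α β else 0 := by
    rw [Finset.sum_filter]
    symm
    rw [Finset.sum_eq_single (full k r t)]
    · simp
    · intro α _ hα
      simp [hα]
    · simp
  rw [rookPoly_kronecker hφ r a _ (toeplitz_apply r a), hsum,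
    sum_pow_KMat_eq_sum_edges (hd := startCap_le k r) hk _ hφ
      (fun α β => α = full k r t ∧ ∀ i, full k r t i ≤ β i)]
  · refine Finset.sum_congr rfl fun q _ => ?_
    rw [colMult_startCap]
    simp only [stateAt_startCap_zero, true_and, full_le_stateAt_iff hrt]
    split_ifs <;> simp
  · intro q w hw h0
    exact hw.eq_of_zero
      (w' := fun s : Fin (n + 1) =>
        stateAt (AddMonoidHom.id ℤ) (startCap k r) (startCap_le k r) q s)
      (fun s => step_stateAt hk q hφ s)
      (h0.1.trans (stateAt_startCap_zero k r q).symm)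

end Toeplitz

/-! ### Generating functions of matrix powers -/

/-- Jacobi's formula for the derivative of a determinant. -/
theorem derivative_det {S ι : Type*} [CommRing S] [Fintype ι] [DecidableEq ι]
    (A : Matrix ι ι S[X]) :
    derivative A.det = (A.adjugate * A.map derivative).trace := by
  -- By Cramer's rule a diagonal entry is the determinant with one column differentiated; summing
  -- over columns is the Leibniz rule.
  have h1 : ∀ b, (A.adjugate * A.map derivative) b b =
      (A.updateCol b fun i => derivative (A i b)).det := by
    intro b
    rw [← Matrix.cramer_apply, Matrix.cramer_eq_adjugate_mulVec, Matrix.mul_apply]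
    rfl
  simp only [Matrix.trace, Matrix.diag_apply, h1, Matrix.det_apply, map_sum]
  rw [Finset.sum_comm]
  refine Finset.sum_congr rfl fun σ _ => ?_
  rw [← Finset.smul_sum, Units.smul_def, Units.smul_def, derivative_smul, derivative_prod_finset]
  congr 1
  refine Finset.sum_congr rfl fun b _ => ?_
  rw [← Finset.prod_erase_mul _ _ (Finset.mem_univ b), Matrix.updateCol_self]
  congr 1
  refine Finset.prod_congr rfl fun i hi => ?_
  rw [Matrix.updateCol_ne (Finset.ne_of_mem_erase hi)]

section PowSeries

variable {S ι : Type*} [CommRing S] [Fintype ι] [DecidableEq ι] (M : Matrix ι ι S)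

/-- The matrix `∑ M ^ n y ^ n` of power series. -/
noncomputable def powSeries : Matrix ι ι (PowerSeries S) :=
  Matrix.of fun i j => PowerSeries.mk fun n => (M ^ n) i j

/-- The geometric series telescopes coefficient by coefficient. -/
theorem powSeries_mul :
    powSeries M * (oneSub M).map Polynomial.coeToPowerSeries.ringHom = 1 := by
  have h1 : (oneSub M).map Polynomial.coeToPowerSeries.ringHom =
      1 - (PowerSeries.X : PowerSeries S) • M.map (PowerSeries.C (R := S)) := by
    ext1 i j
    simp only [oneSub, Matrix.map_apply, Matrix.sub_apply, Matrix.smul_apply, smul_eq_mul, map_sub,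
      map_mul, coeToPowerSeries.ringHom_apply, Polynomial.coe_X, Polynomial.coe_C]
    congr 1
    rw [Matrix.one_apply, Matrix.one_apply]
    split_ifs <;> simp
  rw [h1, mul_sub, mul_one, Matrix.mul_smul]
  ext i j n
  rw [Matrix.sub_apply, Matrix.smul_apply, smul_eq_mul, map_sub, Matrix.mul_apply]
  cases n with
  | zero =>
    simp only [powSeries, Matrix.of_apply, PowerSeries.coeff_mk, PowerSeries.coeff_zero_X_mul,
      sub_zero, pow_zero, Matrix.one_apply]
    split_ifs <;> simp
  | succ n =>
    rw [PowerSeries.coeff_succ_X_mul, map_sum]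
    simp only [powSeries, Matrix.of_apply, PowerSeries.coeff_mk, Matrix.map_apply,
      PowerSeries.coeff_mul_C]
    rw [pow_succ, Matrix.mul_apply, sub_self, Matrix.one_apply]
    split_ifs <;> simp [PowerSeries.coeff_one]

theorem isUnit_det_oneSub : IsUnit (((oneSub M).det : S[X]) : PowerSeries S) := by
  have h := congrArg Matrix.det (powSeries_mul M)
  rw [Matrix.det_mul, Matrix.det_one, ← RingHom.mapMatrix_apply, ← RingHom.map_det, mul_comm] at h
  exact IsUnit.of_mul_eq_one _ h

theorem powSeries_mul_det (i j : ι) :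
    powSeries M i j * (((oneSub M).det : S[X]) : PowerSeries S) =
      (((oneSub M).adjugate i j : S[X]) : PowerSeries S) := by
  have h : powSeries M * (oneSub M).map Polynomial.coeToPowerSeries.ringHom *
      ((oneSub M).adjugate).map Polynomial.coeToPowerSeries.ringHom =
      ((oneSub M).adjugate).map Polynomial.coeToPowerSeries.ringHom := by
    rw [powSeries_mul, one_mul]
  rw [mul_assoc, ← Matrix.map_mul, Matrix.mul_adjugate] at h
  have h2 := congrFun (congrFun h i) j
  rw [Matrix.mul_apply, Finset.sum_eq_single j] at h2
  · simpa using h2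
  · intro l _ hl
    simp [hl]
  · simp

theorem eq_quot {F : PowerSeries S} {f g : S[X]} (hg : IsUnit (g : PowerSeries S))
    (h : F * (g : PowerSeries S) = f) : F = quot f g := by
  rw [quot, ← h, mul_assoc, Ring.mul_inverse_cancel _ hg, mul_one]

/-- The derivative of I − yM is −M, so Jacobi's formula turns −y times the derivative of the
determinant into y · tr(adj(I − yM) M), and dividing by the determinant replaces the adjugate by ∑
Mⁿyⁿ. -/
theorem gen_trace_pow :
    gen (fun n => (M ^ n).trace) = quot (-X * derivative (oneSub M).det) (oneSub M).det := by
  refine eq_quot (isUnit_det_oneSub M) ?_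
  have h1 : gen (fun n => (M ^ n).trace) =
      PowerSeries.X * ∑ i, ∑ j, powSeries M i j * PowerSeries.C (M j i) := by
    ext n
    cases n with
    | zero => simp [gen]
    | succ n =>
      rw [PowerSeries.coeff_succ_X_mul]
      simp only [gen, PowerSeries.coeff_mk, Nat.succ_ne_zero, if_false, map_sum,
        PowerSeries.coeff_mul_C, powSeries, Matrix.of_apply, Matrix.trace, Matrix.diag_apply,
        pow_succ, Matrix.mul_apply]
  have h2 : (oneSub M).map derivative = -M.map C := by
    ext1 i j
    rw [Matrix.map_apply, oneSub, Matrix.sub_apply, Matrix.smul_apply, smul_eq_mul,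
      Matrix.map_apply, Matrix.neg_apply, Matrix.map_apply, derivative_sub, derivative_mul,
      derivative_X, derivative_C, one_mul, mul_zero, add_zero, Matrix.one_apply]
    split_ifs <;> simp
  rw [h1, derivative_det, h2, mul_neg, Matrix.trace_neg, neg_mul_neg, Matrix.trace, mul_assoc,
    Finset.sum_mul, Polynomial.coe_mul, Polynomial.coe_X]
  simp only [Matrix.diag_apply, Matrix.mul_apply, Finset.sum_mul]
  congr 1
  rw [← coeToPowerSeries.ringHom_apply (φ := ∑ i, _), map_sum]
  refine Finset.sum_congr rfl fun i _ => ?_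
  rw [map_sum]
  refine Finset.sum_congr rfl fun j _ => ?_
  rw [map_mul, coeToPowerSeries.ringHom_apply, coeToPowerSeries.ringHom_apply, ← powSeries_mul_det, Matrix.map_apply, Polynomial.coe_C]
  ring

/-- Numbering from 0 instead of 1 changes both signs, hence not their product. -/
theorem adjugate_eq_minor {N : ℕ} (L : ι ≃ Fin (N + 1)) (A : Matrix ι ι S) (α β : ι) :
    A.adjugate α β = (-1) ^ (L α : ℕ) * ((-1) ^ (L β : ℕ) * minor L A β α) := by
  have h := Matrix.adjugate_fin_succ_eq_det_submatrix (A.submatrix L.symm L.symm) (L α) (L β)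
  rw [Matrix.adjugate_submatrix_equiv_self, Matrix.submatrix_apply, L.symm_apply_apply,
    L.symm_apply_apply] at h
  rw [h, minor, ← mul_assoc, ← pow_add, add_comm]

end PowSeries

/-! ### The four generating functions -/

section GeneratingFunctions

variable {R : Type*} [CommRing R] {k r t : ℕ} (a : Fin (t + 1) → R)

theorem one_add_gen {S : Type*} [CommRing S] (f : ℕ → S) (h : f 0 = 1) :
    1 + gen f = PowerSeries.mk f := by
  ext n
  cases n with
  | zero => simp [gen, h]
  | succ n => simp [gen, PowerSeries.coeff_one]

theorem gen_congr {S : Type*} [CommRing S] {f g : ℕ → S} (h : ∀ n, n ≠ 0 → f n = g n) :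
    gen f = gen g := by
  ext n
  simp only [gen, PowerSeries.coeff_mk]
  split_ifs with hn
  · rfl
  · exact h n hn

theorem rookPoly_of_isEmpty {m n : Type*} [Fintype m] [DecidableEq m] [Fintype n] [DecidableEq n]
    [IsEmpty m] (A : Matrix m n R) : rookPoly A = 1 := by
  rw [rookPoly_eq_rookSum, rookSum_of_isEmpty]

theorem eq_of_le_of_sum_eq {α β : G k t} (h : ∀ i, α i ≤ β i)
    (hs : ∑ i, (β i : ℕ) = ∑ i, (α i : ℕ)) : β = α := by
  have h2 := (Finset.sum_eq_sum_iff_of_le fun i _ => Fin.le_def.1 (h i)).1 hs.symm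
  funext i
  exact Fin.ext (h2 i (Finset.mem_univ i)).symm

/-- Among the end states containing u, any one other than u has a larger total and so no top
coefficient. -/
theorem permanent_toeplitz (hrt : r ≤ t) (n : ℕ) :
    (toeplitz r a n ⊗ₖ JMat R k).permanent =
      (PiMat k (r * k) t a ^ n) (fullSum k hrt) (fullSum k hrt) := by
  rw [← coeff_rookPoly_card, Fintype.card_prod, Fintype.card_fin, Fintype.card_fin,
    rookPoly_toeplitz hrt, finsetSum_coeff, ← coeff_pow_KMat, Finset.sum_eq_single (full k r t)]
  · rfl
  · intro γ hγ hne
    have hle := (Finset.mem_filter.1 hγ).2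
    refine coeff_pow_KMat_eq_zero a n (lt_of_le_of_ne (Finset.sum_le_sum fun i _ => hle i) ?_)
    exact fun h => hne (eq_of_le_of_sum_eq hle h.symm)
  · simp

/-- The trace of Kⁿ splits by the total l of the state, and in top degree each part is the trace of
Π_lⁿ. -/
theorem permanent_circulant (r : ℕ) {n : ℕ} (hn : n ≠ 0) :
    (circulant r a n ⊗ₖ JMat R k).permanent =
      ∑ l ∈ Finset.range (k * t + 1), (PiMat k l t a ^ n).trace := by
  rw [← coeff_rookPoly_card, Fintype.card_prod, Fintype.card_fin, Fintype.card_fin,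
    rookPoly_circulant hn, Matrix.trace, finsetSum_coeff,
    ← Finset.sum_fiberwise_of_maps_to (t := Finset.range (k * t + 1))
      (g := fun α : G k t => ∑ i, (α i : ℕ))]
  · refine Finset.sum_congr rfl fun l _ => ?_
    rw [Finset.sum_subtype (p := fun γ : G k t => ∑ i, (γ i : ℕ) = l) _ (by simp), Matrix.trace]
    exact Finset.sum_congr rfl fun α _ => coeff_pow_KMat a n α α
  · intro α _
    rw [Finset.mem_range, Nat.lt_succ_iff]
    refine (Finset.sum_le_card_nsmul _ _ k fun i _ => Nat.le_of_lt_succ (α i).2).trans ?_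
    simp [mul_comm]

end GeneratingFunctions

end RookToeplitz

theorem theorem22 {R : Type*} [CommRing R] (k r t : ℕ) (hrt : r ≤ t) (a : Fin (t + 1) → R) :
    -- the denominators are invertible power series
    (IsUnit (((oneSub (KMat k t fun i => C (a i) * X)).det : R[X][X]) : PowerSeries R[X]) ∧
      ∀ l : ℕ, IsUnit (((oneSub (PiMat k l t a)).det : R[X]) : PowerSeries R)) ∧
    -- rook polynomials, Toeplitz case
    (∀ (N : ℕ) (L : G k t ≃ Fin (N + 1)),
      1 + gen (fun n => rookPoly (toeplitz r a n ⊗ₖ JMat R k)) =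
        quot
          ((-1) ^ (L (full k r t) : ℕ) *
            ∑ γ : G k t with ∀ i, full k r t i ≤ γ i,
              (-1) ^ (L γ : ℕ) *
                minor L (oneSub (KMat k t fun i => C (a i) * X)) γ (full k r t))
          (oneSub (KMat k t fun i => C (a i) * X)).det) ∧
    -- rook polynomials, circulant case
    gen (fun n => rookPoly (circulant r a n ⊗ₖ JMat R k)) =
      quot
        (-X * derivative (oneSub (KMat k t fun i => C (a i) * X)).det)
        (oneSub (KMat k t fun i => C (a i) * X)).det ∧
    -- permanents, Toeplitz case
    (∀ (N : ℕ) (L : GSum k (r * k) t ≃ Fin (N + 1)),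
      1 + gen (fun n => (toeplitz r a n ⊗ₖ JMat R k).permanent) =
        quot
          (minor L (oneSub (PiMat k (r * k) t a)) (fullSum k hrt) (fullSum k hrt))
          (oneSub (PiMat k (r * k) t a)).det) ∧
    -- permanents, circulant case
    gen (fun n => (circulant r a n ⊗ₖ JMat R k).permanent) =
      ∑ l ∈ Finset.range (k * t + 1),
        quot
          (-X * derivative (oneSub (PiMat k l t a)).det)
          (oneSub (PiMat k l t a)).det := by
  refine ⟨⟨isUnit_det_oneSub _, fun l => isUnit_det_oneSub _⟩, fun N L => ?_, ?_, fun N L => ?_, ?_⟩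
  · refine eq_quot (isUnit_det_oneSub _) ?_
    -- The leading 1 is the rook polynomial of the empty matrix, matching the identity matrix K⁰.
    rw [one_add_gen _ (rookPoly_of_isEmpty _)]
    have h : (PowerSeries.mk fun n => rookPoly (toeplitz r a n ⊗ₖ JMat R k)) =
        ∑ γ : G k t with ∀ i, full k r t i ≤ γ i,
          powSeries (KMat k t fun i => C (a i) * X) (full k r t) γ := by
      ext1 n
      rw [PowerSeries.coeff_mk, rookPoly_toeplitz hrt, map_sum]
      simp only [powSeries, Matrix.of_apply, PowerSeries.coeff_mk]
    rw [h, Finset.sum_mul, Finset.sum_congr rfl fun γ _ => powSeries_mul_det _ _ γ, Finset.mul_sum]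
    simp only [adjugate_eq_minor L]
    exact (map_sum coeToPowerSeries.ringHom _ _).symm
  · rw [gen_congr fun n hn => rookPoly_circulant hn r a, gen_trace_pow]
  · refine eq_quot (isUnit_det_oneSub _) ?_
    rw [one_add_gen _ (Matrix.permanent_isEmpty)]
    have h : (PowerSeries.mk fun n => (toeplitz r a n ⊗ₖ JMat R k).permanent) =
        powSeries (PiMat k (r * k) t a) (fullSum k hrt) (fullSum k hrt) := by
      ext n
      rw [PowerSeries.coeff_mk, permanent_toeplitz a hrt, powSeries, Matrix.of_apply,
        PowerSeries.coeff_mk]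
    rw [h, powSeries_mul_det, adjugate_eq_minor L, ← mul_assoc, ← pow_add,
      (Even.add_self _).neg_one_pow, one_mul]
  · rw [gen_congr fun n hn => permanent_circulant a r hn]
    simp only [← gen_trace_pow]
    ext n
    simp only [gen, PowerSeries.coeff_mk, map_sum]
    split_ifs <;> simp
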